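/- **Projection complexes.** Let $\mathbb{Y}$ be a set, $\theta\ge 0$, and for each $y\in\mathbb{Y}$ let $d_y\colon (\mathbb{Y}\setminus\{y\})\times(\mathbb{Y}\setminus\{y\})\to\mathbb{R}_{\ge0}$ be a function such that, whenever the terms are defined: $d_y(x,z)=d_y(z,x)$; $d_y(x,w)\le d_y(x,z)+d_y(z,w)$; $\min\{d_y(x,z),d_z(x,y)\}\le\theta$; and $\{y : d_y(x,z)>\theta\}$ is finite for all $x,z$. For $x\ne z$ let $\mathcal{H}(x,z)$ be the set of pairs $(x',z')$ with $x'\neq z'$ such that one of the following holds (the terms involved being defined): $d_x(x',z')>2\theta$ and $d_z(x',z')>2\theta$; or $x'=x$ and $d_z(x,z')>2\theta$; or $z'=z$ and $d_x(x',z)>2\theta$; or $(x',z')=(x,z)$. For pairwise distinct $x,y,z$ put $d'_y(x,z)=0$ if $y$ occurs in a pair in $\mathcal{H}(x,z)$, and $d'_y(x,z)=\inf_{(x',z')\in\mathcal{H}(x,z)}d_y(x',z')$ otherwise (the modified distance functions of Bestvina–Bromberg–Fujiwara). For $K\ge0$ let $\mathcal{P}=\mathcal{P}_K(\mathbb{Y})$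 be the graph with vertex set $\mathbb{Y}$ in which distinct $x,z$ are adjacent iff $d'_y(x,z)\le K$ for all $y\notin\{x,z\}$, with path metric $d$. We call $\mathcal{P}$ a *projection complex* if it is connected and there are constants $C_e,C_p,C_g$ such that: $d_y(x,z)\le C_e$ whenever $x\ne y\ne z$ and $d(x,z)=1$; $d_y(x,z)\le C_p$ whenever some edge path from $x$ to $z$ contains no vertex at distance $\le 2$ from $y$; and $d_y(x,z)\le C_g$ whenever some geodesic from $x$ to $z$ does not contain the vertex $y$. A group $G$ *acts on* $\mathcal{P}$ if it acts on $\mathbb{Y}$ with $d_{gy}(gx,gz)=d_y(x,z)$ for all $g\in G$. **WPD elements.** Let a group $G$ act by isometries on $X$. An element $f$ is *hyperbolic* if $\lim_{n\to\infty}d(x,f^nx)/n>0$ for some (equivalently, any) $x$. Hyperbolic elements $f_1,f_2$ are *independent* if $d(f_1^{n_1}x,f_2^{n_2}x)\to\infty$ as $n_1,n_2\to\pm\infty$ for some (equivalently, any) $x$. An element $f$ is *WPD* if it is hyperbolic and for all $x$ and all $D\ge0$ there is an integer $M\ge0$ such that $\{g\in G: d(x,gx)\le D,\ d(f^Mx,gf^Mx)\le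 D\}$ is finite. The action is *non-elementary WPD* if some two WPD elements of $G$ are independent. **Spinning families.** Let $G$ act on a projection complex $\mathcal{P}$ and let $L>0$. A family of subgroups $R_v\le\mathrm{Stab}_G(v)$, one for each vertex $v$, is an *equivariant $L$-spinning family* if $gR_vg^{-1}=R_{gv}$ for all $g\in G$ and all vertices $v$, and $d_v(w,hw)\ge L$ for all distinct vertices $v,w$ and all $1\ne h\in R_v$. The subgroup $\langle R_v\rangle$ generated by all $R_v$ is then normal, and $G/\langle R_v\rangle$ acts on the quotient graph $\mathcal{P}/\langle R_v\rangle$ with its path metric. **Theorem 1.2.** Let $\mathcal{P}$ be a projection complex and let $G$ be a group acting on $\mathcal{P}$. (1) If the action of $G$ on $\mathcal{P}$ is non-elementary WPD, then there is a constant $L_{\mathrm{WPD}}(\mathcal{P},G)>0$ such that for every $L\ge L_{\mathrm{WPD}}(\mathcal{P},G)$ and every equivariant $L$-spinning family $\{R_v\}$ of subgroups of $G$, the action of $G/\langle R_v\rangle$ on $\mathcal{P}/\langle R_v\rangle$ is non-elementary WPD. (2) Precisely, if $f_1,f_2\in G$ are independent WPD elements for the action on $\mathcal{P}$, then there is a constant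 $L_{\mathrm{WPD}}(\mathcal{P},f_1,f_2)>0$ such that for every $L\ge L_{\mathrm{WPD}}(\mathcal{P},f_1,f_2)$ and every equivariant $L$-spinning family $\{R_v\}$ of subgroups of $G$, the images $\bar f_1,\bar f_2\in G/\langle R_v\rangle$ are independent WPD elements for the action of $G/\langle R_v\rangle$ on $\mathcal{P}/\langle R_v\rangle$. -/

import Mathlib

open Filter

universe u v

/-! ### Projection data and projection complexes -/

/-- A set `Y` with functions `d y : (Y \ {y}) × (Y \ {y}) → ℝ≥0` and a constant `θ ≥ 0` satisfying
the projection complex axioms. `d y x z` is written as a total function; every axiom, and every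
later use of `d`, only concerns the values `d y x z` with `x ≠ y` and `z ≠ y`. -/
structure ProjectionData (Y : Type v) where
  θ : ℝ
  θ_nonneg : 0 ≤ θ
  d : Y → Y → Y → ℝ
  nonneg : ∀ y x z, x ≠ y → z ≠ y → 0 ≤ d y x z
  symmetry : ∀ y x z, x ≠ y → z ≠ y → d y x z = d y z x
  triangle : ∀ y x z w, x ≠ y → z ≠ y → w ≠ y → d y x w ≤ d y x z + d y z w
  triples : ∀ x y z, x ≠ y → y ≠ z → x ≠ z → min (d y x z) (d z x y) ≤ θ
  finiteness : ∀ x z, {y | y ≠ x ∧ y ≠ z ∧ θ < d y x z}.Finite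

namespace ProjectionData

variable {Y : Type v} (D : ProjectionData Y)

/-- The set `H(x, z)` of pairs of distinct points used by Bestvina--Bromberg--Fujiwara
to modify the distance functions. -/
def modPairs (x z : Y) : Set (Y × Y) :=
  {p | p.1 ≠ p.2 ∧
    ((x ≠ p.1 ∧ x ≠ p.2 ∧ z ≠ p.1 ∧ z ≠ p.2 ∧
        2 * D.θ < D.d x p.1 p.2 ∧ 2 * D.θ < D.d z p.1 p.2) ∨
      (p.1 = x ∧ z ≠ x ∧ z ≠ p.2 ∧ 2 * D.θ < D.d z x p.2) ∨
      (p.2 = z ∧ x ≠ p.1 ∧ x ≠ z ∧ 2 * D.θ < D.d x p.1 z) ∨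
      (p.1 = x ∧ p.2 = z))}

open Classical in
/-- The modified distance function `d'_y(x, z)` of Bestvina--Bromberg--Fujiwara, for pairwise
distinct `x, y, z`: it is `0` if `y` is an entry of some pair in `H(x, z)`, and otherwise the
infimum of `d_y(x', z')` over the pairs `(x', z') ∈ H(x, z)`. -/
noncomputable def modDist (y x z : Y) : ℝ :=
  if ∃ p ∈ D.modPairs x z, y = p.1 ∨ y = p.2 then 0
  else sInf ((fun p : Y × Y => D.d y p.1 p.2) '' D.modPairs x z)

theorem modPairs_swap {x z : Y} {p : Y × Y} (hp : p ∈ D.modPairs x z) :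
    p.swap ∈ D.modPairs z x := by
  obtain ⟨a, b⟩ := p
  obtain ⟨hne, h⟩ := hp
  simp only at hne h
  refine ⟨fun h' => hne h'.symm, ?_⟩
  simp only [Prod.fst_swap, Prod.snd_swap]
  rcases h with ⟨h1, h2, h3, h4, h5, h6⟩ | ⟨h1, h2, h3, h4⟩ | ⟨h1, h2, h3, h4⟩ | ⟨h1, h2⟩
  · refine Or.inl ⟨h4, h3, h2, h1, ?_, ?_⟩
    · rwa [D.symmetry z b a h4.symm h3.symm]
    · rwa [D.symmetry x b a h2.symm h1.symm]
  · refine Or.inr (Or.inr (Or.inl ⟨h1, h3, h2, ?_⟩))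
    rwa [D.symmetry z b x h3.symm h2.symm]
  · refine Or.inr (Or.inl ⟨h1, h3, h2, ?_⟩)
    rwa [D.symmetry x z a h3.symm h2.symm]
  · exact Or.inr (Or.inr (Or.inr ⟨h2, h1⟩))

theorem modDist_comm (y x z : Y) : D.modDist y x z = D.modDist y z x := by
  have key : ∀ x z : Y, (∃ p ∈ D.modPairs x z, y = p.1 ∨ y = p.2) →
      ∃ p ∈ D.modPairs z x, y = p.1 ∨ y = p.2 := fun x z ⟨p, hp, h⟩ =>
    ⟨p.swap, D.modPairs_swap hp, h.symm⟩
  unfold modDist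
  by_cases h : ∃ p ∈ D.modPairs x z, y = p.1 ∨ y = p.2
  · rw [if_pos h, if_pos (key x z h)]
  · have h' : ¬ ∃ p ∈ D.modPairs z x, y = p.1 ∨ y = p.2 := fun h' => h (key z x h')
    rw [if_neg h, if_neg h']
    have sub : ∀ x z : Y, (¬ ∃ p ∈ D.modPairs x z, y = p.1 ∨ y = p.2) →
        (fun p : Y × Y => D.d y p.1 p.2) '' D.modPairs x z ⊆
          (fun p : Y × Y => D.d y p.1 p.2) '' D.modPairs z x := by
      rintro x z hn _ ⟨p, hp, rfl⟩
      refine ⟨p.swap, D.modPairs_swap hp, ?_⟩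
      refine D.symmetry y p.2 p.1 ?_ ?_
      · exact fun e => hn ⟨p, hp, Or.inr e.symm⟩
      · exact fun e => hn ⟨p, hp, Or.inl e.symm⟩
    rw [(sub x z h).antisymm (sub z x h')]

/-- The graph `P_K(Y)`: distinct `x, z` are adjacent iff `d'_y(x, z) ≤ K` for all `y ∉ {x, z}`. -/
def graph (K : ℝ) : SimpleGraph Y where
  Adj x z := x ≠ z ∧ ∀ y, y ≠ x → y ≠ z → D.modDist y x z ≤ K
  symm := ⟨fun x z h => ⟨h.1.symm, fun y hz hx => by
    rw [D.modDist_comm y z x]; exact h.2 y hx hz⟩⟩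
  loopless := ⟨fun _ h => h.1 rfl⟩

end ProjectionData

/-- A projection complex `P_K(Y)`: projection data together with a constant `K ≥ 0` for which the
graph `P_K(Y)` is connected (so that its path metric is defined) and has bounded edge, path and
geodesic images. -/
structure ProjectionComplex (Y : Type v) extends ProjectionData Y where
  K : ℝ
  K_nonneg : 0 ≤ K
  connected : (toProjectionData.graph K).Connected
  bounded_edge_image : ∃ Ce : ℝ, ∀ x y z : Y, x ≠ y → y ≠ z →
    (toProjectionData.graph K).dist x z = 1 → d y x z ≤ Ce
  bounded_path_image : ∃ Cp : ℝ, ∀ (x y z : Y) (p : (toProjectionData.graph K).Walk x z),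
    (∀ w ∈ p.support, 2 < (toProjectionData.graph K).dist y w) → d y x z ≤ Cp
  bounded_geodesic_image : ∃ Cg : ℝ, ∀ (x y z : Y) (p : (toProjectionData.graph K).Walk x z),
    p.length = (toProjectionData.graph K).dist x z → y ∉ p.support → d y x z ≤ Cg

/-- The path metric on the vertices of a graph in which every edge has length one. -/
noncomputable def graphDist {V : Type v} (Γ : SimpleGraph V) (x y : V) : ℝ := (Γ.dist x y : ℝ)

namespace ProjectionComplex

variable {Y : Type v} (P : ProjectionComplex Y)

/-- The underlying graph of a projection complex. -/
def toGraph : SimpleGraph Y := P.toProjectionData.graph P.K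

/-- An action of `G` on the vertex set `Y` is an action on the projection complex if the distance
functions are invariant: `d_{gy}(gx, gz) = d_y(x, z)`. -/
def IsActedOnBy (G : Type u) [Group G] [MulAction G Y] : Prop :=
  ∀ (g : G) (y x z : Y), x ≠ y → z ≠ y → P.d (g • y) (g • x) (g • z) = P.d y x z

end ProjectionComplex

/-! ### Hyperbolic, independent and WPD elements

These notions are defined for a group `G` acting on a set `X` with a distance function `dist'`.
For graphs they are used on the vertex set with the path metric; since every point of the graph is
within distance `1/2` of a vertex, interior points of edges give nothing new. -/

section WPD

variable {G : Type u} [Group G] {X : Type v} [MulAction G X] (dist' : X → X → ℝ)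

/-- `f` is hyperbolic: `lim d(x, fⁿ x) / n` is positive for some `x`. -/
def IsHyperbolicElement (f : G) : Prop :=
  ∃ x : X, ∃ τ : ℝ, 0 < τ ∧
    Tendsto (fun n : ℕ => dist' x (f ^ n • x) / (n : ℝ)) atTop (nhds τ)

/-- `f` is a WPD element: it is hyperbolic, and for all points `x` and all `D ≥ 0` there is an
`M ≥ 0` such that only finitely many `g ∈ G` satisfy `d(x, gx) ≤ D` and `d(f^M x, g f^M x) ≤ D`. -/
def IsWPDElement (f : G) : Prop :=
  IsHyperbolicElement dist' f ∧ ∀ (x : X) (D : ℝ), 0 ≤ D → ∃ M : ℕ,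
    {g : G | dist' x (g • x) ≤ D ∧ dist' (f ^ M • x) (g • f ^ M • x) ≤ D}.Finite

/-- `f₁` and `f₂` are independent: both are hyperbolic, and for some `x`,
`d(f₁^{n₁} x, f₂^{n₂} x) → ∞` as `n₁, n₂ → ±∞`. -/
def AreIndependent (f₁ f₂ : G) : Prop :=
  IsHyperbolicElement dist' f₁ ∧ IsHyperbolicElement dist' f₂ ∧
    ∃ x : X, Tendsto (fun n : ℤ × ℤ => dist' (f₁ ^ n.1 • x) (f₂ ^ n.2 • x))
      ((atBot ⊔ atTop) ×ˢ (atBot ⊔ atTop)) atTop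

/-- `f₁` and `f₂` are independent WPD elements. -/
def AreIndependentWPD (f₁ f₂ : G) : Prop :=
  IsWPDElement dist' f₁ ∧ IsWPDElement dist' f₂ ∧ AreIndependent dist' f₁ f₂

variable (G) in
/-- The action of `G` on `X` is a non-elementary WPD action. -/
def IsNonelementaryWPDAction : Prop := ∃ f₁ f₂ : G, AreIndependentWPD dist' f₁ f₂

end WPD

/-! ### Equivariant spinning families and quotients -/

/-- An equivariant `L`-spinning family of subgroups of `G`. -/
structure SpinningFamily {Y : Type v} (P : ProjectionComplex Y) (G : Type u) [Group G]
    [MulAction G Y] (L : ℝ) where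
  R : Y → Subgroup G
  le_stabilizer : ∀ v, R v ≤ MulAction.stabilizer G v
  equivariant : ∀ (g : G) (v : Y), (R v).map (MulAut.conj g).toMonoidHom = R (g • v)
  spinning : ∀ v w : Y, v ≠ w → ∀ h ∈ R v, h ≠ 1 → L ≤ P.d v w (h • w)

namespace SpinningFamily

variable {Y : Type v} {P : ProjectionComplex Y} {G : Type u} [Group G] [MulAction G Y] {L : ℝ}
  (S : SpinningFamily P G L)

/-- The subgroup `⟨R_v⟩` of `G` generated by all the `R_v`. -/
def subgroup : Subgroup G := ⨆ v, S.R v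

instance subgroup_normal : S.subgroup.Normal := by
  refine ⟨fun n hn g => ?_⟩
  have h : S.subgroup.map (MulAut.conj g).toMonoidHom ≤ S.subgroup := by
    unfold subgroup
    rw [Subgroup.map_iSup]
    refine iSup_le fun v => ?_
    rw [S.equivariant g v]
    exact le_iSup S.R (g • v)
  exact h (Subgroup.mem_map_of_mem (MulAut.conj g).toMonoidHom hn)

/-- The vertex set of the quotient `P / ⟨R_v⟩`: the orbits of vertices. -/
def QuotVertex : Type v := MulAction.orbitRel.Quotient S.subgroup Y

/-- The orbit of a vertex. -/
def proj (x : Y) : S.QuotVertex := Quotient.mk (MulAction.orbitRel S.subgroup Y) x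

theorem proj_eq_iff {x y : Y} : S.proj x = S.proj y ↔ ∃ h ∈ S.subgroup, h • y = x := by
  refine Quotient.eq.trans ?_
  rw [MulAction.orbitRel_apply, MulAction.mem_orbit_iff]
  constructor
  · rintro ⟨h, rfl⟩
    exact ⟨h, h.2, rfl⟩
  · rintro ⟨h, hh, rfl⟩
    exact ⟨⟨h, hh⟩, rfl⟩

/-- The quotient graph `P / ⟨R_v⟩`: two distinct orbits are adjacent iff they contain adjacent
vertices. (Loops and multiple edges of the topological quotient do not affect the path metric.) -/
def quotGraph : SimpleGraph S.QuotVertex where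
  Adj a b := a ≠ b ∧ ∃ x y : Y, S.proj x = a ∧ S.proj y = b ∧ P.toGraph.Adj x y
  symm := ⟨fun _ _ ⟨hne, x, y, hx, hy, h⟩ => ⟨hne.symm, y, x, hy, hx, h.symm⟩⟩
  loopless := ⟨fun _ h => h.1 rfl⟩

theorem proj_smul_congr {g g' : G} {x x' : Y} (hg : g⁻¹ * g' ∈ S.subgroup)
    (hx : S.proj x = S.proj x') : S.proj (g • x) = S.proj (g' • x') := by
  obtain ⟨h, hh, rfl⟩ := S.proj_eq_iff.1 hx
  refine S.proj_eq_iff.2 ⟨g * (h * (g⁻¹ * g')⁻¹) * g⁻¹,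
    S.subgroup_normal.conj_mem _ (mul_mem hh (inv_mem hg)) g, ?_⟩
  rw [smul_smul, smul_smul]
  congr 1
  group

/-- The action of `G / ⟨R_v⟩` on the vertices of `P / ⟨R_v⟩`, given by `ḡ • [x] = [g • x]`. -/
instance : MulAction (G ⧸ S.subgroup) S.QuotVertex where
  smul := fun q a => Quotient.liftOn₂ q a (fun g x => S.proj (g • x))
    (fun _ _ _ _ hg hx => S.proj_smul_congr (QuotientGroup.leftRel_apply.1 hg) (Quotient.sound hx))
  one_smul := by
    rintro ⟨x⟩
    exact congrArg S.proj (one_smul G x)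
  mul_smul := by
    rintro ⟨g⟩ ⟨g'⟩ ⟨x⟩
    exact congrArg S.proj (mul_smul g g' x)

/-- The image `f̄` of `f` in `G / ⟨R_v⟩`. -/
def image (f : G) : G ⧸ S.subgroup := QuotientGroup.mk f

theorem image_smul_proj (g : G) (x : Y) : S.image g • S.proj x = S.proj (g • x) := rfl

end SpinningFamily

/-!
Let `C` dominate `θ` and the bounds on edge, path and geodesic images, and suppose that `L` is much
larger than `C`. The proof rests on a Greendlinger-type property of spinning families
(`SpinningFamily.isShortenable`): for every vertex `y`, every `h ∈ ⟨R_v⟩` can be reduced to `1` by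
successive left multiplications by rotations `s ∈ R_v`, where each time `v = h y` or `d_v(y, h y)`
is large.

The Greendlinger property is proved with windmills. Starting from `W₀ = {y}`, the set `Wₙ₊₁` is the
orbit of `Wₙ` and its neighbours under the group generated by the rotations about them. If outside
vertices see `Wₙ` with small diameter, then an element of this group that is not a product of
rotations about `Wₙ` has a reduced form `r₁ ⋯ rₖ g`, with rotations `rᵢ` about neighbours of `Wₙ`.
The centres of rotation, suitably translated, form a sequence with a large turn at each
term, and by the Behrstock inequality the turns persist globally (`IsSpinWord.large_turn`). The
first one gives the shortening `r₁⁻¹ h`. The same argument bounds the projections of `Wₙ₊₁` to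
outside vertices (`IsWindmill.hull`); the bounded path image keeps the bound from growing with `n`.

If `d_v(x, z)` is bounded for all `v`, each shortening of `h` with `y = z` occurs at a vertex `v` on
a geodesic from `x` to `h z`, so `d(x, z) ≤ d(x, h z)`. Hence the quotient map preserves the
distance of `x` and `z` (`SpinningFamily.graphDist_proj_eq`). Orbits of hyperbolic elements have
uniformly bounded projections (`IsActedOnBy.exists_orbit_bound`), so hyperbolicity and independence
pass to the quotient. For the WPD property, `IsShortenable.exists_close` lifts an element that moves
two points of the quotient little to an element of `G` that moves two lifts little, provided that
the lifts have bounded projections: it shortens `h` along the quadrilateral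
`x, g x, g z, h z`.
-/

/-! ### Image bounds and invariance under the action -/

namespace ProjectionComplex

variable {Y : Type v} {P : ProjectionComplex Y}

variable (P) in
theorem toGraph_connected : P.toGraph.Connected := P.connected

/-- A single constant that dominates `θ` and the bounds of the edge, path and geodesic images.
The axioms do not make `d y x x` vanish, so its boundedness is recorded as well. -/
structure IsImageBound (P : ProjectionComplex Y) (C : ℝ) : Prop where
  nonneg : 0 ≤ C
  theta_le : P.θ ≤ C
  edge : ∀ {x y z : Y}, x ≠ y → z ≠ y → P.toGraph.Adj x z → P.d y x z ≤ C
  path : ∀ {x y z : Y} (p : P.toGraph.Walk x z),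
    (∀ w ∈ p.support, 2 < P.toGraph.dist y w) → P.d y x z ≤ C
  geodesic : ∀ {x y z : Y} (p : P.toGraph.Walk x z),
    p.length = P.toGraph.dist x z → y ∉ p.support → P.d y x z ≤ C
  self : ∀ {x y : Y}, x ≠ y → P.d y x x ≤ C

variable (P) in
theorem exists_isImageBound : ∃ C : ℝ, P.IsImageBound C := by
  obtain ⟨Ce, he⟩ := P.bounded_edge_image
  obtain ⟨Cp, hp⟩ := P.bounded_path_image
  obtain ⟨Cg, hg⟩ := P.bounded_geodesic_image
  have h1 : P.θ ≤ max P.θ (max Ce (max Cp Cg)) := le_max_left _ _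
  have h2 : Ce ≤ max P.θ (max Ce (max Cp Cg)) := (le_max_left _ _).trans (le_max_right _ _)
  have h3 : Cp ≤ max P.θ (max Ce (max Cp Cg)) :=
    ((le_max_left _ _).trans (le_max_right _ _)).trans (le_max_right _ _)
  have h4 : Cg ≤ max P.θ (max Ce (max Cp Cg)) :=
    ((le_max_right _ _).trans (le_max_right _ _)).trans (le_max_right _ _)
  exact ⟨_, {
    nonneg := P.θ_nonneg.trans h1
    theta_le := h1
    edge := fun hx hz h => (he _ _ _ hx hz.symm (SimpleGraph.dist_eq_one_iff_adj.2 h)).trans h2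
    path := fun p h => (hp _ _ _ p h).trans h3
    geodesic := fun p hl h => (hg _ _ _ p hl h).trans h4
    self := fun {x y} h =>
      (hg x y x SimpleGraph.Walk.nil (by simp) (by simpa using h.symm)).trans h4 }⟩

namespace IsImageBound

variable {C : ℝ}

/-- The Behrstock inequality: if `x` and `z` are far apart seen from `y`, then `x` and `y` are
close seen from `z`. -/
theorem behrstock (hC : P.IsImageBound C) {x y z : Y} (hxy : x ≠ y) (hyz : y ≠ z) (hxz : x ≠ z)
    (h : C < P.d y x z) : P.d z x y ≤ C := by
  have := hC.theta_le
  rcases min_le_iff.1 (P.triples x y z hxy hyz hxz) with h' | h' <;> linarith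

theorem dist_eq_of_mem_geodesic {x z v : Y} {p : P.toGraph.Walk x z}
    (hp : p.length = P.toGraph.dist x z) (hv : v ∈ p.support) :
    P.toGraph.dist x v + P.toGraph.dist v z ≤ P.toGraph.dist x z := by
  classical
  have h := congrArg SimpleGraph.Walk.length (p.take_spec hv)
  rw [SimpleGraph.Walk.length_append] at h
  have h1 := SimpleGraph.dist_le (p.takeUntil v hv)
  have h2 := SimpleGraph.dist_le (p.dropUntil v hv)
  omega

/-- Bounded geodesic images: a vertex with a large projection cuts distances. -/
theorem dist_add_dist_le (hC : P.IsImageBound C) {x v z : Y} (h : C < P.d v x z) :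
    P.toGraph.dist x v + P.toGraph.dist v z ≤ P.toGraph.dist x z := by
  obtain ⟨p, hp⟩ := P.toGraph_connected.exists_walk_length_eq_dist x z
  by_cases hv : v ∈ p.support
  · exact dist_eq_of_mem_geodesic hp hv
  · exact absurd (hC.geodesic p hp hv) (not_le.2 h)

end IsImageBound

namespace IsActedOnBy

variable {G : Type u} [Group G] [MulAction G Y]

theorem d_smul_right (hG : P.IsActedOnBy G) (g : G) {u a b : Y} (ha : a ≠ u) (hb : g • b ≠ u) :
    P.d u a (g • b) = P.d (g⁻¹ • u) (g⁻¹ • a) b := by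
  have h := hG g (g⁻¹ • u) (g⁻¹ • a) b ((MulAction.injective g⁻¹).ne ha)
    (fun e => hb (by rw [e, smul_inv_smul]))
  simpa using h

theorem smul_mem_modPairs (hG : P.IsActedOnBy G) (g : G) {x z : Y} {p : Y × Y}
    (hp : p ∈ P.modPairs x z) : (g • p.1, g • p.2) ∈ P.modPairs (g • x) (g • z) := by
  obtain ⟨hne, h⟩ := hp
  have e {a b : Y} : g • a ≠ g • b ↔ a ≠ b := (MulAction.injective g).ne_iff
  refine ⟨e.2 hne, ?_⟩
  rcases h with ⟨h1, h2, h3, h4, h5, h6⟩ | ⟨h1, h2, h3, h4⟩ | ⟨h1, h2, h3, h4⟩ | ⟨h1, h2⟩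
  · refine Or.inl ⟨e.2 h1, e.2 h2, e.2 h3, e.2 h4, ?_, ?_⟩
    · rwa [hG g x _ _ h1.symm h2.symm]
    · rwa [hG g z _ _ h3.symm h4.symm]
  · refine Or.inr (Or.inl ⟨congrArg _ h1, e.2 h2, e.2 h3, ?_⟩)
    rwa [hG g z _ _ h2.symm h3.symm]
  · refine Or.inr (Or.inr (Or.inl ⟨congrArg _ h1, e.2 h2, e.2 h3, ?_⟩))
    rwa [hG g x _ _ h2.symm h3.symm]
  · exact Or.inr (Or.inr (Or.inr ⟨congrArg _ h1, congrArg _ h2⟩))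

theorem smul_mem_modPairs_iff (hG : P.IsActedOnBy G) (g : G) {x z : Y} {p : Y × Y} :
    (g • p.1, g • p.2) ∈ P.modPairs (g • x) (g • z) ↔ p ∈ P.modPairs x z := by
  refine ⟨fun h => ?_, hG.smul_mem_modPairs g⟩
  simpa using hG.smul_mem_modPairs g⁻¹ h

theorem modDist_smul (hG : P.IsActedOnBy G) (g : G) (y x z : Y) :
    P.modDist (g • y) (g • x) (g • z) = P.modDist y x z := by
  have key : (∃ p ∈ P.modPairs (g • x) (g • z), g • y = p.1 ∨ g • y = p.2) ↔
      ∃ p ∈ P.modPairs x z, y = p.1 ∨ y = p.2 := by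
    constructor
    · rintro ⟨p, hp, h⟩
      refine ⟨(g⁻¹ • p.1, g⁻¹ • p.2), (hG.smul_mem_modPairs_iff g).1 (by simpa using hp), ?_⟩
      simpa [eq_inv_smul_iff] using h
    · rintro ⟨p, hp, h⟩
      exact ⟨_, hG.smul_mem_modPairs g hp, by simpa using h⟩
  unfold ProjectionData.modDist
  by_cases h : ∃ p ∈ P.modPairs x z, y = p.1 ∨ y = p.2
  · rw [if_pos h, if_pos (key.2 h)]
  · rw [if_neg h, if_neg (key.not.2 h)]
    congr 1
    have hne : ∀ p ∈ P.modPairs x z, P.d (g • y) (g • p.1) (g • p.2) = P.d y p.1 p.2 :=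
      fun p hp => hG g y _ _ (fun e => h ⟨p, hp, Or.inl e.symm⟩)
        (fun e => h ⟨p, hp, Or.inr e.symm⟩)
    ext t
    constructor
    · rintro ⟨p, hp, rfl⟩
      have hp' : (g⁻¹ • p.1, g⁻¹ • p.2) ∈ P.modPairs x z :=
        (hG.smul_mem_modPairs_iff g).1 (by simpa using hp)
      exact ⟨_, hp', by simpa using (hne _ hp').symm⟩
    · rintro ⟨p, hp, rfl⟩
      exact ⟨_, hG.smul_mem_modPairs g hp, hne p hp⟩

theorem adj_smul (hG : P.IsActedOnBy G) (g : G) {x z : Y} (h : P.toGraph.Adj x z) :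
    P.toGraph.Adj (g • x) (g • z) := by
  refine ⟨(MulAction.injective g).ne h.1, fun y hx hz => ?_⟩
  have := h.2 (g⁻¹ • y) (fun e => hx (by simp [← e])) (fun e => hz (by simp [← e]))
  rwa [← hG.modDist_smul g, smul_inv_smul] at this

theorem dist_smul_le (hG : P.IsActedOnBy G) (g : G) (x z : Y) :
    P.toGraph.dist (g • x) (g • z) ≤ P.toGraph.dist x z := by
  obtain ⟨p, hp⟩ := P.toGraph_connected.exists_walk_length_eq_dist x z
  have := SimpleGraph.dist_le
    (p.map (⟨(g • ·), hG.adj_smul g⟩ : P.toGraph →g P.toGraph))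
  rw [SimpleGraph.Walk.length_map] at this
  exact this.trans hp.le

theorem dist_smul (hG : P.IsActedOnBy G) (g : G) (x z : Y) :
    P.toGraph.dist (g • x) (g • z) = P.toGraph.dist x z := by
  refine (hG.dist_smul_le g x z).antisymm ?_
  simpa using hG.dist_smul_le g⁻¹ (g • x) (g • z)

theorem dist_smul_comm (hG : P.IsActedOnBy G) (g : G) (x z : Y) :
    P.toGraph.dist (g • x) z = P.toGraph.dist x (g⁻¹ • z) := by
  simpa using hG.dist_smul g x (g⁻¹ • z)

end IsActedOnBy

end ProjectionComplex

/-! ### Windmills -/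

/-- The vertices `a` and `b` are joined by a walk inside `W`. -/
def SimpleGraph.JoinedWithin {V : Type*} (Γ : SimpleGraph V) (W : Set V) (a b : V) : Prop :=
  ∃ p : Γ.Walk a b, ∀ w ∈ p.support, w ∈ W

namespace SimpleGraph.JoinedWithin

variable {V : Type*} {Γ : SimpleGraph V} {W : Set V} {a b c : V}

theorem refl (ha : a ∈ W) : Γ.JoinedWithin W a a := ⟨.nil, by simpa using ha⟩

theorem symm (h : Γ.JoinedWithin W a b) : Γ.JoinedWithin W b a := by
  obtain ⟨p, hp⟩ := h
  exact ⟨p.reverse, by simpa using hp⟩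

theorem trans (h : Γ.JoinedWithin W a b) (h' : Γ.JoinedWithin W b c) :
    Γ.JoinedWithin W a c := by
  obtain ⟨p, hp⟩ := h
  obtain ⟨q, hq⟩ := h'
  refine ⟨p.append q, fun w hw => ?_⟩
  rcases (SimpleGraph.Walk.mem_support_append_iff p q).1 hw with h | h
  exacts [hp w h, hq w h]

theorem of_adj (ha : a ∈ W) (hb : b ∈ W) (h : Γ.Adj a b) : Γ.JoinedWithin W a b :=
  ⟨.cons h .nil, by simp [ha, hb]⟩

theorem map {W' : Set V} (f : Γ →g Γ) (hf : ∀ w ∈ W, f w ∈ W') (h : Γ.JoinedWithin W a b) :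
    Γ.JoinedWithin W' (f a) (f b) := by
  obtain ⟨p, hp⟩ := h
  refine ⟨p.map f, fun w hw => ?_⟩
  rw [SimpleGraph.Walk.support_map, List.mem_map] at hw
  obtain ⟨w, hw, rfl⟩ := hw
  exact hf w (hp w hw)

theorem mono {W' : Set V} (hW : W ⊆ W') (h : Γ.JoinedWithin W a b) : Γ.JoinedWithin W' a b :=
  h.imp fun _ hp w hw => hW (hp w hw)

end SimpleGraph.JoinedWithin

/-- The closed neighbourhood of radius one of a set of vertices. -/
def SimpleGraph.collar {V : Type*} (Γ : SimpleGraph V) (W : Set V) : Set V :=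
  {v | v ∈ W ∨ ∃ w ∈ W, Γ.Adj w v}

theorem SimpleGraph.subset_collar {V : Type*} (Γ : SimpleGraph V) (W : Set V) :
    W ⊆ Γ.collar W := fun _ => Or.inl

namespace ProjectionComplex.IsImageBound

variable {Y : Type v} {P : ProjectionComplex Y} {C : ℝ} {W : Set Y}

theorem exists_mem_dist_le (hC : P.IsImageBound C) {b u : Y} (hb : b ∈ P.toGraph.collar W)
    (hbu : b ≠ u) (hu : u ∉ W) : ∃ w ∈ W, P.d u b w ≤ C := by
  rcases hb with hb | ⟨w, hw, h⟩
  · exact ⟨b, hb, hC.self hbu⟩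
  · exact ⟨w, hw, hC.edge hbu (fun e => hu (e ▸ hw)) h.symm⟩

/-- Passing from a set to its collar changes the projections by at most `2 * C`. -/
theorem collar_bound (hC : P.IsImageBound C) {u : Y} (hu : u ∉ W) {K : ℝ}
    (hK : ∀ a ∈ W, ∀ b ∈ W, P.d u a b ≤ K) {a b : Y} (ha : a ∈ P.toGraph.collar W)
    (hb : b ∈ P.toGraph.collar W) (hau : a ≠ u) (hbu : b ≠ u) : P.d u a b ≤ K + 2 * C := by
  obtain ⟨a', ha', h1⟩ := hC.exists_mem_dist_le ha hau hu
  obtain ⟨b', hb', h2⟩ := hC.exists_mem_dist_le hb hbu hu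
  have hau' : a' ≠ u := fun e => hu (e ▸ ha')
  have hbu' : b' ≠ u := fun e => hu (e ▸ hb')
  have h3 := P.triangle u a a' b hau hau' hbu
  have h4 := P.triangle u a' b' b hau' hbu' hbu
  have h5 := P.symmetry u b b' hbu hbu'
  have h6 := hK a' ha' b' hb'
  linarith

end ProjectionComplex.IsImageBound

namespace SpinningFamily

variable {Y : Type v} {P : ProjectionComplex Y} {G : Type u} [Group G] [MulAction G Y] {L : ℝ}
  (S : SpinningFamily P G L)

/-- The subgroup generated by the `R_v` with `v ∈ W`. -/
def rotation (W : Set Y) : Subgroup G := Subgroup.closure {h | ∃ v ∈ W, h ∈ S.R v}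

variable {S} in
theorem mem_rotation {W : Set Y} {v : Y} (hv : v ∈ W) {r : G} (hr : r ∈ S.R v) :
    r ∈ S.rotation W := Subgroup.subset_closure ⟨v, hv, hr⟩

theorem rotation_mono {W W' : Set Y} (h : W ⊆ W') : S.rotation W ≤ S.rotation W' :=
  Subgroup.closure_mono fun _ ⟨v, hv, hr⟩ => ⟨v, h hv, hr⟩

variable {S} in
theorem rotation_induction {W : Set Y} {p : G → Prop} (one : p 1)
    (mul : ∀ v ∈ W, ∀ r ∈ S.R v, ∀ h, p h → p (r * h)) {h : G} (hh : h ∈ S.rotation W) : p h := by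
  induction hh using Subgroup.closure_induction_left with
  | one => exact one
  | mul_left x hx y _ ih =>
    obtain ⟨v, hv, hr⟩ := hx
    exact mul v hv x hr y ih
  | inv_mul_cancel x hx y _ ih =>
    obtain ⟨v, hv, hr⟩ := hx
    exact mul v hv x⁻¹ (inv_mem hr) y ih

variable {S} in
theorem smul_self {v : Y} {r : G} (hr : r ∈ S.R v) : r • v = v := S.le_stabilizer v hr

variable {S} in
theorem conj_mem {v : Y} {r : G} (hr : r ∈ S.R v) (g : G) : g * r * g⁻¹ ∈ S.R (g • v) := by
  rw [← S.equivariant g v]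
  exact Subgroup.mem_map_of_mem (MulAut.conj g).toMonoidHom hr

/-- The set obtained from `W` by adding its neighbours and then rotating about all vertices
reached so far. -/
def hull (W : Set Y) : Set Y :=
  {x | ∃ h ∈ S.rotation (P.toGraph.collar W), ∃ b ∈ P.toGraph.collar W, h • b = x}

theorem collar_subset_hull (W : Set Y) : P.toGraph.collar W ⊆ S.hull W :=
  fun b hb => ⟨1, one_mem _, b, hb, one_smul _ _⟩

theorem subset_hull (W : Set Y) : W ⊆ S.hull W :=
  (P.toGraph.subset_collar W).trans (S.collar_subset_hull W)

variable {S} in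
theorem smul_mem_hull {W : Set Y} {h : G} (hh : h ∈ S.rotation (P.toGraph.collar W)) {x : Y}
    (hx : x ∈ S.hull W) : h • x ∈ S.hull W := by
  obtain ⟨k, hk, b, hb, rfl⟩ := hx
  exact ⟨h * k, mul_mem hh hk, b, hb, mul_smul _ _ _⟩

theorem rotation_hull_le (W : Set Y) :
    S.rotation (S.hull W) ≤ S.rotation (P.toGraph.collar W) := by
  refine (Subgroup.closure_le _).2 ?_
  rintro r ⟨_, ⟨k, hk, b, hb, rfl⟩, hr⟩
  have h := conj_mem hr k⁻¹
  rw [inv_smul_smul] at h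
  have h' := mul_mem (mul_mem hk (mem_rotation hb h)) (inv_mem hk)
  have e : k * (k⁻¹ * r * k⁻¹⁻¹) * k⁻¹ = r := by group
  rwa [e] at h'

/-- The invariants of a windmill: a connected set of vertices, invariant under the rotations about
its elements, with small projections to outside vertices, and with even smaller projections to
vertices that are not adjacent to it. The second bound keeps the first one from growing when the
windmill is enlarged. -/
structure IsWindmill (C : ℝ) (W : Set Y) : Prop where
  joined : ∀ a ∈ W, ∀ b ∈ W, P.toGraph.JoinedWithin W a b
  smul_mem : ∀ h ∈ S.rotation W, ∀ w ∈ W, h • w ∈ W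
  near : ∀ u ∉ W, ∀ a ∈ W, ∀ b ∈ W, P.d u a b ≤ 13 * C
  far : ∀ u, (∀ w ∈ W, 1 < P.toGraph.dist u w) → ∀ a ∈ W, ∀ b ∈ W, P.d u a b ≤ 7 * C

/-- `S.IsSpinWord W v h` says that `h = r₁ ⋯ rₖ g` with `k ≥ 1`, where `1 ≠ rᵢ ∈ R_{vᵢ}` for
vertices `vᵢ` of the collar of `W` outside `W`, consecutive `vᵢ` differ, `v₁ = v`, and `g` is a
product of rotations about elements of `W`. -/
inductive IsSpinWord (W : Set Y) : Y → G → Prop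
  | single {v : Y} {r g : G} (hv : v ∈ P.toGraph.collar W) (hvW : v ∉ W) (hr : r ∈ S.R v)
      (hr1 : r ≠ 1) (hg : g ∈ S.rotation W) : IsSpinWord W v (r * g)
  | cons {v v' : Y} {r h : G} (hv : v ∈ P.toGraph.collar W) (hvW : v ∉ W) (hr : r ∈ S.R v)
      (hr1 : r ≠ 1) (hh : IsSpinWord W v' h) (hne : v' ≠ v) : IsSpinWord W v (r * h)

variable {S} {C : ℝ} {W : Set Y}

namespace IsSpinWord

theorem mem_collar {v : Y} {h : G} (hw : S.IsSpinWord W v h) : v ∈ P.toGraph.collar W := by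
  cases hw <;> assumption

theorem notMem {v : Y} {h : G} (hw : S.IsSpinWord W v h) : v ∉ W := by
  cases hw <;> assumption

theorem mem_rotation {v : Y} {h : G} (hw : S.IsSpinWord W v h) :
    h ∈ S.rotation (P.toGraph.collar W) := by
  induction hw with
  | single hv _ hr _ hg =>
    exact mul_mem (SpinningFamily.mem_rotation hv hr)
      (S.rotation_mono (P.toGraph.subset_collar W) hg)
  | cons hv _ hr _ _ _ ih => exact mul_mem (SpinningFamily.mem_rotation hv hr) ih

end IsSpinWord

namespace IsWindmill

theorem smul_notMem (hW : S.IsWindmill C W) {g : G} (hg : g ∈ S.rotation W) {w : Y}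
    (hw : w ∉ W) : g • w ∉ W := fun h => hw (by
  simpa using hW.smul_mem g⁻¹ (inv_mem hg) _ h)

theorem smul_mem_collar (hG : P.IsActedOnBy G) (hW : S.IsWindmill C W) {g : G}
    (hg : g ∈ S.rotation W) {b : Y} (hb : b ∈ P.toGraph.collar W) :
    g • b ∈ P.toGraph.collar W := by
  rcases hb with hb | ⟨w, hw, hb⟩
  · exact Or.inl (hW.smul_mem g hg b hb)
  · exact Or.inr ⟨g • w, hW.smul_mem g hg w hw, hG.adj_smul g hb⟩

theorem mul_isSpinWord (hG : P.IsActedOnBy G) (hW : S.IsWindmill C W) {g : G}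
    (hg : g ∈ S.rotation W) {v : Y} {h : G} (hh : S.IsSpinWord W v h) :
    S.IsSpinWord W (g • v) (g * h) := by
  have ne {r : G} (hr : r ≠ 1) : g * r * g⁻¹ ≠ 1 := by simpa using hr
  induction hh with
  | @single v r k hv hvW hr hr1 hk =>
    have e : g * (r * k) = g * r * g⁻¹ * (g * k) := by group
    rw [e]
    exact .single (hW.smul_mem_collar hG hg hv) (hW.smul_notMem hg hvW) (conj_mem hr g) (ne hr1)
      (mul_mem hg hk)
  | @cons v v' r k hv hvW hr hr1 _ hne ih =>
    have e : g * (r * k) = g * r * g⁻¹ * (g * k) := by group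
    rw [e]
    exact .cons (hW.smul_mem_collar hG hg hv) (hW.smul_notMem hg hvW) (conj_mem hr g) (ne hr1)
      ih ((MulAction.injective g).ne hne)

/-- Every product of rotations about the collar of a windmill can be brought into reduced form. -/
theorem mem_rotation_or_isSpinWord (hG : P.IsActedOnBy G) (hW : S.IsWindmill C W) {h : G}
    (hh : h ∈ S.rotation (P.toGraph.collar W)) :
    h ∈ S.rotation W ∨ ∃ v, S.IsSpinWord W v h := by
  refine rotation_induction (p := fun h => h ∈ S.rotation W ∨ ∃ v, S.IsSpinWord W v h)
    (Or.inl (one_mem _)) (fun v hv r hr h ih => ?_) hh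
  by_cases hvW : v ∈ W
  · have hrW := mem_rotation hvW hr
    rcases ih with ih | ⟨v', ih⟩
    · exact Or.inl (mul_mem hrW ih)
    · exact Or.inr ⟨_, hW.mul_isSpinWord hG hrW ih⟩
  by_cases hr1 : r = 1
  · simpa [hr1] using ih
  rcases ih with ih | ⟨v', ih⟩
  · exact Or.inr ⟨v, .single hv hvW hr hr1 ih⟩
  by_cases hne : v' = v
  · subst hne
    cases ih with
    | @single _ r' g _ _ hr' _ hg =>
      rw [← mul_assoc]
      by_cases h1 : r * r' = 1
      · exact Or.inl (by rwa [h1, one_mul])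
      · exact Or.inr ⟨v', .single hv hvW (mul_mem hr hr') h1 hg⟩
    | @cons _ v'' r' k _ _ hr' _ hk hne' =>
      rw [← mul_assoc]
      by_cases h1 : r * r' = 1
      · exact Or.inr ⟨v'', by rwa [h1, one_mul]⟩
      · exact Or.inr ⟨v', .cons hv hvW (mul_mem hr hr') h1 hk hne'⟩
  · exact Or.inr ⟨v, .cons hv hvW hr hr1 ih hne⟩

end IsWindmill

namespace IsSpinWord

/-- A reduced word makes a large turn at its first vertex `v`, as seen from any `a` that looks, from
`v`, like a point `v₀` of the collar. The vertices `v₁`, `r₁ v₂`, `r₁ r₂ v₃`, … form a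
local quasi-geodesic, which the Behrstock inequality shows to be global. -/
theorem large_turn (hC : P.IsImageBound C) (hG : P.IsActedOnBy G) (hL : 40 * C < L)
    (hW : S.IsWindmill C W) {v : Y} {h : G} (hh : S.IsSpinWord W v h) {w : Y} (hw : w ∈ W) :
    h • w ≠ v ∧ ∀ a v₀, v₀ ∈ P.toGraph.collar W → v₀ ≠ v → a ≠ v → P.d v a v₀ ≤ C →
      L - 17 * C ≤ P.d v a (h • w) := by
  have hC0 := hC.nonneg
  -- the projections of the collar to `v` are small, so a rotation about `v` turns by almost `L`
  have turn {v : Y} (hvW : v ∉ W) {r : G} (hr : r ∈ S.R v) (hr1 : r ≠ 1) {c a v₀ : Y}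
      (hc : c ∈ P.toGraph.collar W) (hcv : c ≠ v) (h0 : v₀ ∈ P.toGraph.collar W) (h0v : v₀ ≠ v)
      (hav : a ≠ v) (ha : P.d v a v₀ ≤ C) : L - 16 * C ≤ P.d v a (r • c) := by
    have hrc : r • c ≠ v := fun e => hcv ((MulAction.injective r) (e.trans (smul_self hr).symm))
    have h1 := S.spinning v c hcv.symm r hr hr1
    have h2 := P.triangle v c v₀ (r • c) hcv h0v hrc
    have h3 := P.triangle v v₀ a (r • c) h0v hav hrc
    have h4 := hC.collar_bound hvW (hW.near v hvW) hc h0 hcv h0v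
    have h5 := P.symmetry v v₀ a h0v hav
    linarith
  induction hh with
  | @single v r g hv hvW hr hr1 hg =>
    have hgw : g • w ∈ W := hW.smul_mem g hg w hw
    have hgv : g • w ≠ v := fun e => hvW (e ▸ hgw)
    refine ⟨fun e => hgv ?_, fun a v₀ h0 h0v hav ha => ?_⟩
    · rw [mul_smul] at e
      exact (MulAction.injective r) (e.trans (smul_self hr).symm)
    · rw [mul_smul]
      have := turn hvW hr hr1 (Or.inl hgw) hgv h0 h0v hav ha
      linarith
  | @cons v v' r h hv hvW hr hr1 hh hne ih =>
    obtain ⟨hb', ih⟩ := ih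
    have h1 : L - 17 * C ≤ P.d v' v (h • w) := ih v v hv hne.symm hne.symm (hC.self hne.symm)
    have hbv : h • w ≠ v := by
      intro e
      rw [e] at h1
      have := hC.self hne.symm
      linarith
    have hrb : r • h • w ≠ v := fun e =>
      hbv ((MulAction.injective r) (e.trans (smul_self hr).symm))
    rw [mul_smul]
    refine ⟨hrb, fun a v₀ h0 h0v hav ha => ?_⟩
    have hrv' : r • v' ≠ v := fun e =>
      hne ((MulAction.injective r) (e.trans (smul_self hr).symm))
    have h2 : P.d v (h • w) v' ≤ C := by
      rw [P.symmetry v _ _ hbv hne]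
      rw [P.symmetry v' _ _ hne.symm hb'] at h1
      have h3 := hC.behrstock (x := h • w) (y := v') (z := v) hb' hne hbv (by linarith)
      rwa [P.symmetry v _ _ hbv hne] at h3
    have h3 : P.d v (r • v') (r • h • w) = P.d v v' (h • w) := by
      have := hG r v v' (h • w) hne hbv
      rwa [smul_self hr] at this
    have h4 := turn hvW hr hr1 hh.mem_collar hne h0 h0v hav ha
    have h5 := P.triangle v a (r • h • w) (r • v') hav hrb hrv'
    rw [P.symmetry v _ _ hrb hrv', h3, P.symmetry v _ _ hne hbv] at h5
    linarith

/-- A vertex `u` outside the hull sees the path of a reduced word with a bound that does not depend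
on the length of the word: before some translate of the collar everything looks close to where the
path enters it, and after it everything looks close to where the path leaves it, by the Behrstock
inequality and the large turns. -/
theorem projection_le (hC : P.IsImageBound C) (hG : P.IsActedOnBy G) (hL : 40 * C < L)
    (hW : S.IsWindmill C W) {K : ℝ} {v : Y} {h : G} (hh : S.IsSpinWord W v h) {w : Y}
    (hw : w ∈ W) : ∀ u, u ∉ S.hull W →
    (∀ k ∈ S.rotation (P.toGraph.collar W), ∀ a ∈ W, ∀ b ∈ W, P.d (k • u) a b ≤ K) →
    ∀ a v₀, v₀ ∈ P.toGraph.collar W → v₀ ≠ v → a ≠ v → a ≠ u → P.d v a v₀ ≤ C →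
      P.d u a v₀ ≤ C → P.d u a (h • w) ≤ K + 4 * C := by
  have hC0 := hC.nonneg
  have collar {u : Y} (hu : u ∉ S.hull W) {b : Y} (hb : b ∈ P.toGraph.collar W) : b ≠ u :=
    fun e => hu (e ▸ S.collar_subset_hull W hb)
  have bound {u : Y} (hu : u ∉ S.hull W)
      (hK : ∀ k ∈ S.rotation (P.toGraph.collar W), ∀ a ∈ W, ∀ b ∈ W, P.d (k • u) a b ≤ K)
      {a b : Y} (ha : a ∈ P.toGraph.collar W) (hb : b ∈ P.toGraph.collar W) :
      P.d u a b ≤ K + 2 * C :=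
    hC.collar_bound (fun h => hu (S.subset_hull W h))
      (by simpa using hK 1 (one_mem _)) ha hb (collar hu ha) (collar hu hb)
  have step {v : Y} {h : G} (hh : S.IsSpinWord W v h) {u : Y} (hu : u ∉ S.hull W)
      (hK : ∀ k ∈ S.rotation (P.toGraph.collar W), ∀ a ∈ W, ∀ b ∈ W, P.d (k • u) a b ≤ K)
      {a v₀ : Y} (h0 : v₀ ∈ P.toGraph.collar W) (h0v : v₀ ≠ v) (hav : a ≠ v) (hau : a ≠ u)
      (ha : P.d v a v₀ ≤ C) (ha' : P.d u a v₀ ≤ C) :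
      P.d u a (h • w) ≤ K + 4 * C ∨ P.d u a v ≤ C := by
    obtain ⟨hbv, hturn⟩ := hh.large_turn hC hG hL hW hw
    have hturn := hturn a v₀ h0 h0v hav ha
    have hvu := collar hu hh.mem_collar
    have hbu : h • w ≠ u := fun e => hu (e ▸ smul_mem_hull hh.mem_rotation (S.subset_hull W hw))
    by_cases hcase : C < P.d v (h • w) u
    · left
      have h1 := hC.behrstock hbv hvu hbu hcase
      have h2 := P.triangle u a v₀ (h • w) hau (collar hu h0) hbu
      have h3 := P.triangle u v₀ v (h • w) (collar hu h0) hvu hbu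
      have h4 := bound hu hK h0 hh.mem_collar
      rw [P.symmetry u _ _ hbu hvu] at h1
      linarith
    · right
      refine hC.behrstock hav hvu hau ?_
      have h1 := P.triangle v a u (h • w) hav hvu.symm hbv
      rw [P.symmetry v _ _ hvu.symm hbv] at h1
      linarith
  have back {k : G} (hk : k ∈ S.rotation (P.toGraph.collar W)) {u : Y} (hu : u ∉ S.hull W) :
      k⁻¹ • u ∉ S.hull W := fun h => hu (by simpa using smul_mem_hull hk h)
  induction hh with
  | @single v r g hv hvW hr hr1 hg =>
    intro u hu hK a v₀ h0 h0v hav hau ha ha'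
    have hword : S.IsSpinWord W v (r * g) := .single hv hvW hr hr1 hg
    rcases step hword hu hK h0 h0v hav hau ha ha' with h | h
    · exact h
    have hrB := SpinningFamily.mem_rotation hv hr
    have hgw : g • w ∈ W := hW.smul_mem g hg w hw
    have hvu := collar hu hv
    have hbu : r • g • w ≠ u := fun e => hu (e ▸ smul_mem_hull hrB (S.subset_hull W hgw))
    have h1 := P.triangle u a v (r • g • w) hau hvu hbu
    rw [hG.d_smul_right r hvu hbu, smul_self (inv_mem hr)] at h1
    have h2 : P.d (r⁻¹ • u) v (g • w) ≤ K + 2 * C := by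
      refine bound (back hrB hu) (fun k hk => ?_) hv (Or.inl hgw)
      rw [← mul_smul]
      exact hK _ (mul_mem hk (inv_mem hrB))
    rw [mul_smul]
    linarith
  | @cons v v' r h hv hvW hr hr1 hh hne ih =>
    intro u hu hK a v₀ h0 h0v hav hau ha ha'
    have hword : S.IsSpinWord W v (r * h) := .cons hv hvW hr hr1 hh hne
    rcases step hword hu hK h0 h0v hav hau ha ha' with h | hauv
    · exact h
    have hrB := SpinningFamily.mem_rotation hv hr
    have hvu := collar hu hv
    have hbu : r • h • w ≠ u := fun e => hu (e ▸ smul_mem_hull hrB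
      (smul_mem_hull hh.mem_rotation (S.subset_hull W hw)))
    have hav' : r⁻¹ • a ≠ v := fun e => hav (by rw [← smul_self hr, ← e, smul_inv_smul])
    have hrv' : r • v' ≠ v := fun e =>
      hne ((MulAction.injective r) (e.trans (smul_self hr).symm))
    have hbig : C < P.d v (r⁻¹ • a) v' := by
      have h1 := S.spinning v v' hne.symm r hr hr1
      have h2 := P.triangle v v' v₀ (r • v') hne h0v hrv'
      have h3 := P.triangle v v₀ a (r • v') h0v hav hrv'
      have h4 := hC.collar_bound hvW (hW.near v hvW) hh.mem_collar h0 hne h0v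
      have h5 := P.symmetry v v₀ a h0v hav
      have h6 := hG.d_smul_right r hav hrv'
      rw [smul_self (inv_mem hr)] at h6
      linarith
    have hav'' : r⁻¹ • a ≠ v' := by
      intro e
      rw [e] at hbig
      exact absurd (hC.self hne) (not_le.2 hbig)
    rw [mul_smul, hG.d_smul_right r hau hbu]
    refine ih (r⁻¹ • u) (back hrB hu) (fun k hk => ?_) (r⁻¹ • a) v hv hne.symm hav''
      ((MulAction.injective _).ne hau) (hC.behrstock hav' hne.symm hav'' hbig) ?_
    · rw [← mul_smul]
      exact hK _ (mul_mem hk (inv_mem hrB))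
    · have h1 := hG r⁻¹ u a v hau hvu
      rw [smul_self (inv_mem hr)] at h1
      rwa [h1]

end IsSpinWord

namespace IsWindmill

/-- If all translates of `u` see `W` with diameter at most `K`, then `u` sees the hull of `W` with
diameter at most `K + 6 * C`. -/
theorem hull_bound (hC : P.IsImageBound C) (hG : P.IsActedOnBy G) (hL : 40 * C < L)
    (hW : S.IsWindmill C W) {K : ℝ} {u : Y} (hu : u ∉ S.hull W)
    (hK : ∀ k ∈ S.rotation (P.toGraph.collar W), ∀ a ∈ W, ∀ b ∈ W, P.d (k • u) a b ≤ K)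
    {x y : Y} (hx : x ∈ S.hull W) (hy : y ∈ S.hull W) : P.d u x y ≤ K + 6 * C := by
  have hC0 := hC.nonneg
  obtain ⟨h₁, hh₁, a, ha, rfl⟩ := hx
  obtain ⟨h₂, hh₂, b, hb, rfl⟩ := hy
  have back {k : G} (hk : k ∈ S.rotation (P.toGraph.collar W)) {u : Y} (hu : u ∉ S.hull W) :
      k⁻¹ • u ∉ S.hull W := fun h => hu (by simpa using smul_mem_hull hk h)
  have ne {u x : Y} (hu : u ∉ S.hull W) (hx : x ∈ S.hull W) : x ≠ u := fun e => hu (e ▸ hx)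
  set k := h₁⁻¹ * h₂ with hk_def
  have hk : k ∈ S.rotation (P.toGraph.collar W) := mul_mem (inv_mem hh₁) hh₂
  have aux {c : Y} (hc : c ∈ P.toGraph.collar W) := S.collar_subset_hull W hc
  set t := h₁⁻¹ • u with ht_def
  have ht : t ∉ S.hull W := back hh₁ hu
  have hKt : ∀ k ∈ S.rotation (P.toGraph.collar W), ∀ a ∈ W, ∀ b ∈ W, P.d (k • t) a b ≤ K := by
    intro k hk
    rw [ht_def, ← mul_smul]
    exact hK _ (mul_mem hk (inv_mem hh₁))
  have e : P.d u (h₁ • a) (h₂ • b) = P.d t a (k • b) := by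
    have := hG h₁⁻¹ u (h₁ • a) (h₂ • b) (ne hu (smul_mem_hull hh₁ (aux ha)))
      (ne hu (smul_mem_hull hh₂ (aux hb)))
    rw [← this, inv_smul_smul, ← mul_smul]
  rw [e]
  obtain ⟨a', ha', h1⟩ := hC.exists_mem_dist_le ha (ne ht (aux ha))
    (fun h => ht (S.subset_hull W h))
  have hs := back hk ht
  obtain ⟨b', hb', h2⟩ := hC.exists_mem_dist_le hb (ne hs (aux hb))
    (fun h => hs (S.subset_hull W h))
  have na := ne ht (aux ha)
  have na' := ne ht (S.subset_hull W ha')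
  have nb := ne ht (smul_mem_hull hk (aux hb))
  have nb' := ne ht (smul_mem_hull hk (S.subset_hull W hb'))
  have h3 := P.triangle t a a' (k • b) na na' nb
  have h4 := P.triangle t a' (k • b') (k • b) na' nb' nb
  have h5 : P.d t (k • b') (k • b) ≤ C := by
    rw [P.symmetry t _ _ nb' nb, hG.d_smul_right k nb nb', inv_smul_smul]
    exact h2
  have h6 : P.d t a' (k • b') ≤ K + 4 * C := by
    rcases hW.mem_rotation_or_isSpinWord hG hk with hkW | ⟨v, hv⟩
    · have := hKt 1 (one_mem _) a' ha' _ (hW.smul_mem k hkW b' hb')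
      rw [one_smul] at this
      linarith
    · have nv : a' ≠ v := fun e => hv.notMem (e ▸ ha')
      exact hv.projection_le hC hG hL hW hb' t ht hKt a' a' (Or.inl ha') nv nv na'
        (hC.self nv) (hC.self na')
  linarith

theorem joined_smul (hG : P.IsActedOnBy G) (hW : S.IsWindmill C W) {h : G}
    (hh : h ∈ S.rotation (P.toGraph.collar W)) {a b : Y} (ha : a ∈ P.toGraph.collar W)
    (hb : b ∈ P.toGraph.collar W) : P.toGraph.JoinedWithin (S.hull W) a (h • b) := by
  have base {a b : Y} (ha : a ∈ P.toGraph.collar W) (hb : b ∈ P.toGraph.collar W) :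
      P.toGraph.JoinedWithin (S.hull W) a b := by
    have toW {a : Y} (ha : a ∈ P.toGraph.collar W) :
        ∃ w ∈ W, P.toGraph.JoinedWithin (S.hull W) w a := by
      rcases ha with ha' | ⟨w, hw, h⟩
      · exact ⟨a, ha', .refl (S.subset_hull W ha')⟩
      · exact ⟨w, hw, .of_adj (S.subset_hull W hw)
          (S.collar_subset_hull W (Or.inr ⟨w, hw, h⟩)) h⟩
    obtain ⟨w, hw, h1⟩ := toW ha
    obtain ⟨w', hw', h2⟩ := toW hb
    exact (h1.symm.trans ((hW.joined w hw w' hw').mono (S.subset_hull W))).trans h2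
  have transl {r : G} (hr : r ∈ S.rotation (P.toGraph.collar W)) {a b : Y}
      (h : P.toGraph.JoinedWithin (S.hull W) a b) :
      P.toGraph.JoinedWithin (S.hull W) (r • a) (r • b) :=
    h.map (⟨(r • ·), hG.adj_smul r⟩ : P.toGraph →g P.toGraph) fun _ hw => smul_mem_hull hr hw
  refine rotation_induction (p := fun h => P.toGraph.JoinedWithin (S.hull W) a (h • b))
    (by simpa using base ha hb) (fun v hv r hr h ih => ?_) hh
  have hrB := mem_rotation hv hr
  -- `v` is fixed by `r`, so it connects `a` to its translate `r • a`
  have h1 := transl hrB (base hv ha)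
  rw [smul_self hr] at h1
  rw [mul_smul]
  exact ((base ha hv).trans h1).trans (transl hrB ih)

theorem hull (hC : P.IsImageBound C) (hG : P.IsActedOnBy G) (hL : 40 * C < L)
    (hW : S.IsWindmill C W) : S.IsWindmill C (S.hull W) := by
  have hC0 := hC.nonneg
  refine ⟨?_, fun h hh w hw => smul_mem_hull (S.rotation_hull_le W hh) hw, fun u hu => ?_,
    fun u hu => ?_⟩
  · rintro _ ⟨h₁, hh₁, a, ha, rfl⟩ _ ⟨h₂, hh₂, b, hb, rfl⟩
    exact (hW.joined_smul hG hh₁ ha ha).symm.trans (hW.joined_smul hG hh₂ ha hb)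
  · intro x hx y hy
    have := hW.hull_bound hC hG hL (K := 7 * C) hu (fun k hk => hW.far _ fun w hw => ?_) hx hy
    · linarith
    · by_contra! hle
      have hku : k • u ∈ P.toGraph.collar W := by
        rcases Nat.le_one_iff_eq_zero_or_eq_one.1 hle with h | h
        · rw [P.toGraph_connected.dist_eq_zero_iff] at h
          exact Or.inl (h ▸ hw)
        · exact Or.inr ⟨w, hw, (SimpleGraph.dist_eq_one_iff_adj.1 h).symm⟩
      exact hu (by simpa using smul_mem_hull (inv_mem hk) (S.collar_subset_hull W hku))
  · intro x hx y hy
    have hu' : u ∉ S.hull W := fun h => by simpa using hu u h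
    have := hW.hull_bound hC hG hL (K := C) hu' (fun k hk a ha b hb => ?_) hx hy
    · linarith
    obtain ⟨p, hp⟩ := hW.joined a ha b hb
    refine hC.path p fun w hw => ?_
    by_contra! hle
    obtain ⟨q, hq⟩ := P.toGraph_connected.exists_walk_length_eq_dist w (k • u)
    rw [SimpleGraph.dist_comm, ← hq] at hle
    -- a vertex of the collar within distance one of `k • u` contradicts the choice of `u`
    have key {b : Y} (hb : b ∈ P.toGraph.collar W) : 1 < P.toGraph.dist (k • u) b := by
      rw [hG.dist_smul_comm]
      exact hu _ (smul_mem_hull (inv_mem hk) (S.collar_subset_hull W hb))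
    cases q with
    | nil => simpa using key (Or.inl (hp _ hw))
    | cons hadj q =>
      have h1 := key (Or.inr ⟨w, hp w hw, hadj⟩)
      have h2 := SimpleGraph.dist_le q
      rw [SimpleGraph.dist_comm] at h2
      rw [SimpleGraph.Walk.length_cons] at hle
      omega

theorem singleton (hC : P.IsImageBound C) (y : Y) : S.IsWindmill C {y} := by
  have hC0 := hC.nonneg
  refine ⟨?_, fun h hh => ?_, ?_, ?_⟩
  · rintro a rfl b rfl
    exact .refl rfl
  · rintro w rfl
    refine rotation_induction (p := fun h => h • w ∈ ({w} : Set Y)) (by simp) ?_ hh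
    rintro v rfl r hr h (ih : h • v = v)
    rw [Set.mem_singleton_iff, mul_smul, ih, smul_self hr]
  · rintro u hu a rfl b rfl
    have := hC.self (x := b) (y := u) (fun e => hu e.symm)
    linarith
  · rintro u hu a rfl b rfl
    have := hC.self (x := b) (y := u) (fun e => by simpa [e] using hu b rfl)
    linarith

end IsWindmill

variable (S) in
/-- The windmills obtained from the vertex `y` by taking hulls repeatedly. -/
def windmill (y : Y) : ℕ → Set Y
  | 0 => {y}
  | n + 1 => S.hull (windmill y n)

theorem isWindmill_windmill (hC : P.IsImageBound C) (hG : P.IsActedOnBy G) (hL : 40 * C < L)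
    (y : Y) : ∀ n, S.IsWindmill C (S.windmill y n)
  | 0 => .singleton hC y
  | n + 1 => (isWindmill_windmill hC hG hL y n).hull hC hG hL

variable (S) in
theorem windmill_mono (y : Y) : Monotone (S.windmill y) :=
  monotone_nat_of_le_succ fun n => S.subset_hull (S.windmill y n)

variable (S) in
theorem exists_mem_windmill (y v : Y) : ∃ n, v ∈ S.windmill y n := by
  obtain ⟨p⟩ := P.toGraph_connected.preconnected v y
  induction p with
  | nil => exact ⟨0, rfl⟩
  | cons h _ ih =>
    obtain ⟨n, hn⟩ := ih
    exact ⟨n + 1, S.collar_subset_hull _ (Or.inr ⟨_, hn, h.symm⟩)⟩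

theorem exists_mem_rotation_windmill (y : Y) {h : G} (hh : h ∈ S.subgroup) :
    ∃ n, h ∈ S.rotation (S.windmill y n) := by
  refine Subgroup.iSup_induction S.R (C := fun h => ∃ n, h ∈ S.rotation (S.windmill y n)) hh
    (fun v r hr => ?_) ⟨0, one_mem _⟩ ?_
  · obtain ⟨n, hn⟩ := S.exists_mem_windmill y v
    exact ⟨n, mem_rotation hn hr⟩
  · rintro g g' ⟨m, hm⟩ ⟨n, hn⟩
    exact ⟨max m n, mul_mem (S.rotation_mono (S.windmill_mono y (le_max_left m n)) hm)
      (S.rotation_mono (S.windmill_mono y (le_max_right m n)) hn)⟩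

variable (S) in
/-- `h` can be reduced to `1` by successive multiplications by rotations `s` about vertices `v`
that either equal `h • y` or see `y` and `h • y` at distance more than `A`. -/
inductive IsShortenable (A : ℝ) (y : Y) : G → Prop
  | one : IsShortenable A y 1
  | step {h s : G} {v : Y} (hs : s ∈ S.R v)
      (hv : v = h • y ∨ (v ≠ y ∧ v ≠ h • y ∧ A < P.d v y (h • y)))
      (hh : IsShortenable A y (s * h)) : IsShortenable A y h

/-- The Greendlinger property of spinning families: every element of `⟨R_v⟩` can be shortened. -/
theorem isShortenable (hC : P.IsImageBound C) (hG : P.IsActedOnBy G) (hL : 40 * C < L) {A : ℝ}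
    (hA : A + 17 * C < L) (y : Y) {h : G} (hh : h ∈ S.subgroup) : S.IsShortenable A y h := by
  obtain ⟨n, hn⟩ := exists_mem_rotation_windmill y hh
  clear hh
  induction n generalizing h with
  | zero =>
    have hy : h ∈ S.R y := by
      refine (Subgroup.closure_le (S.R y)).2 ?_ hn
      rintro r ⟨v, rfl, hr⟩
      exact hr
    refine .step (inv_mem hy) (Or.inl (smul_self hy).symm) ?_
    rw [inv_mul_cancel]
    exact .one
  | succ n ih =>
    have hW := isWindmill_windmill (S := S) hC hG hL y n
    rcases hW.mem_rotation_or_isSpinWord hG (S.rotation_hull_le _ hn) with h' | ⟨v, hv⟩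
    · exact ih h'
    have hy : y ∈ S.windmill y n := S.windmill_mono y (Nat.zero_le n) rfl
    have far {v : Y} {h : G} (hv : S.IsSpinWord (S.windmill y n) v h) :
        v = h • y ∨ (v ≠ y ∧ v ≠ h • y ∧ A < P.d v y (h • y)) := by
      have hvy : v ≠ y := fun e => hv.notMem (e ▸ hy)
      obtain ⟨h1, h2⟩ := hv.large_turn hC hG hL hW hy
      have := h2 y y (Or.inl hy) hvy.symm hvy.symm (hC.self hvy.symm)
      exact Or.inr ⟨hvy, h1.symm, by linarith⟩
    clear hn
    induction hv with
    | @single v r g hv hvW hr hr1 hg =>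
      exact .step (inv_mem hr) (far (.single hv hvW hr hr1 hg)) (by simpa using ih hg)
    | @cons v v' r h hv hvW hr hr1 hh hne ih' =>
      exact .step (inv_mem hr) (far (.cons hv hvW hr hr1 hh hne)) (by simpa using ih')

end SpinningFamily

/-! ### Projections of orbits of hyperbolic elements -/

namespace ProjectionComplex

variable {Y : Type v} {P : ProjectionComplex Y} {G : Type u} [Group G] [MulAction G Y] {C : ℝ}

variable (P) in
theorem exists_projection_bound (a b : Y) : ∃ K : ℝ, ∀ v, a ≠ v → b ≠ v → P.d v a b ≤ K := by
  obtain ⟨K, hK⟩ := ((P.finiteness a b).image fun v => P.d v a b).bddAbove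
  refine ⟨max K P.θ, fun v ha hb => ?_⟩
  by_cases h : P.θ < P.d v a b
  · exact (hK ⟨v, ⟨ha.symm, hb.symm, h⟩, rfl⟩).trans (le_max_left _ _)
  · exact (not_lt.1 h).trans (le_max_right _ _)

theorem IsActedOnBy.dist_zpow_smul (hG : P.IsActedOnBy G) (f : G) (x : Y) (i : ℤ) (n : ℕ) :
    P.toGraph.dist (f ^ i • x) (f ^ (i + n) • x) = P.toGraph.dist x (f ^ n • x) := by
  rw [zpow_add, mul_smul, hG.dist_smul, zpow_natCast]

theorem IsActedOnBy.exists_walk_zpow_smul (hG : P.IsActedOnBy G) (f : G) (x : Y) (i : ℤ) (n : ℕ) :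
    ∃ p : P.toGraph.Walk (f ^ i • x) (f ^ (i + n) • x), ∀ w ∈ p.support, ∃ k : ℤ,
      i ≤ k ∧ k ≤ i + n ∧ P.toGraph.dist w (f ^ k • x) ≤ P.toGraph.dist x (f • x) := by
  induction n with
  | zero =>
    refine ⟨SimpleGraph.Walk.nil.copy rfl (by simp), fun w hw => ⟨i, le_rfl, by simp, ?_⟩⟩
    have : w = f ^ i • x := by simpa using hw
    simp [this]
  | succ n ih =>
    obtain ⟨p, hp⟩ := ih
    obtain ⟨q, hq⟩ := P.toGraph_connected.exists_walk_length_eq_dist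
      (f ^ (i + n) • x) (f ^ (i + (n + 1 : ℕ)) • x)
    refine ⟨p.append q, fun w hw => ?_⟩
    rcases (SimpleGraph.Walk.mem_support_append_iff p q).1 hw with h | h
    · obtain ⟨k, h1, h2, h3⟩ := hp w h
      exact ⟨k, h1, by push_cast; omega, h3⟩
    · refine ⟨i + n, by omega, by push_cast; omega, ?_⟩
      have h1 := IsImageBound.dist_eq_of_mem_geodesic hq h
      have h2 := hG.dist_zpow_smul f x (i + n) 1
      rw [pow_one] at h2
      rw [SimpleGraph.dist_comm]
      push_cast at h1 h2
      rw [add_assoc] at h2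
      omega

/-- The orbit of a point under an element whose powers move it to infinity has uniformly bounded
projections: a vertex near the orbit is close only to a short piece of it, and that piece takes
only finitely many shapes up to translation. -/
theorem IsActedOnBy.exists_orbit_bound (hG : P.IsActedOnBy G) (hC : P.IsImageBound C) {f : G}
    {x : Y} (hf : Tendsto (fun n : ℕ => graphDist P.toGraph x (f ^ n • x)) atTop atTop) :
    ∃ B : ℝ, 0 ≤ B ∧ ∀ (v : Y) (i j : ℤ), f ^ i • x ≠ v → f ^ j • x ≠ v →
      P.d v (f ^ i • x) (f ^ j • x) ≤ B := by
  have hC0 := hC.nonneg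
  set l := P.toGraph.dist x (f • x) with hl
  obtain ⟨m, hm⟩ := eventually_atTop.1 (hf.eventually_gt_atTop ((2 * (l + 2) : ℕ) : ℝ))
  have hm (n : ℕ) (hn : m ≤ n) : 2 * (l + 2) < P.toGraph.dist x (f ^ n • x) := by
    have h := hm n hn
    unfold graphDist at h
    exact_mod_cast h
  choose K hK using fun n : ℕ => P.exists_projection_bound x (f ^ n • x)
  obtain ⟨b, hb⟩ := ((Set.finite_Iic (2 * m)).image K).bddAbove
  have short (v : Y) (i : ℤ) (n : ℕ) (hn : n ≤ 2 * m) (h1 : f ^ i • x ≠ v)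
      (h2 : f ^ (i + n) • x ≠ v) : P.d v (f ^ i • x) (f ^ (i + n) • x) ≤ b := by
    have e : f ^ (i + n) • x = f ^ i • f ^ n • x := by rw [zpow_add, mul_smul, zpow_natCast]
    rw [e] at h2 ⊢
    rw [hG.d_smul_right _ h1 h2, inv_smul_smul]
    refine (hK n _ (fun e => h1 (by rw [e, smul_inv_smul]))
      (fun e => h2 (by rw [e, smul_inv_smul]))).trans (hb ⟨n, hn, rfl⟩)
  have away (v : Y) (i j : ℤ) (hij : i ≤ j)
      (h : ∀ k, i ≤ k → k ≤ j → l + 2 < P.toGraph.dist v (f ^ k • x)) :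
      P.d v (f ^ i • x) (f ^ j • x) ≤ C := by
    obtain ⟨n, hn⟩ := Int.le.dest hij
    subst hn
    obtain ⟨p, hp⟩ := hG.exists_walk_zpow_smul f x i n
    refine hC.path p fun w hw => ?_
    obtain ⟨k, h1, h2, h3⟩ := hp w hw
    have h4 := h k h1 h2
    have h5 := P.toGraph_connected.dist_triangle (u := v) (v := w) (w := f ^ k • x)
    omega
  have main (v : Y) (i j : ℤ) (hij : i ≤ j) (hi : f ^ i • x ≠ v) (hj : f ^ j • x ≠ v) :
      P.d v (f ^ i • x) (f ^ j • x) ≤ 2 * C + max b 0 := by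
    have hb0 := le_max_left b 0
    have hb1 := le_max_right b 0
    by_cases hk : ∀ k, i ≤ k → k ≤ j → l + 2 < P.toGraph.dist v (f ^ k • x)
    · have := away v i j hij hk
      linarith
    push Not at hk
    obtain ⟨k, hik, hkj, hk⟩ := hk
    have out (k' : ℤ) (h : k' + m ≤ k ∨ k + m ≤ k') :
        l + 2 < P.toGraph.dist v (f ^ k' • x) := by
      by_contra! hle
      have h1 := P.toGraph_connected.dist_triangle (u := f ^ k • x) (v := v) (w := f ^ k' • x)
      rw [SimpleGraph.dist_comm (u := f ^ k • x) (v := v)] at h1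
      rcases h with h | h
      · obtain ⟨n, hn⟩ := Int.le.dest (show k' ≤ k by omega)
        have h2 := hG.dist_zpow_smul f x k' n
        have h3 := hm n (by omega)
        rw [hn, SimpleGraph.dist_comm] at h2
        omega
      · obtain ⟨n, hn⟩ := Int.le.dest (show k ≤ k' by omega)
        have h2 := hG.dist_zpow_smul f x k n
        have h3 := hm n (by omega)
        rw [hn] at h2
        omega
    have ne_of_out {k' : ℤ} (h : l + 2 < P.toGraph.dist v (f ^ k' • x)) : f ^ k' • x ≠ v := by
      intro e
      simp [e] at h
    obtain ⟨i', hi', hi1, hii', hi'v⟩ : ∃ i' : ℤ, k - m ≤ i' ∧ i' ≤ k ∧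
        P.d v (f ^ i • x) (f ^ i' • x) ≤ C ∧ f ^ i' • x ≠ v := by
      by_cases h : k - m ≤ i
      · exact ⟨i, h, hik, hC.self hi, hi⟩
      · exact ⟨k - m, le_rfl, by omega, away v i (k - m) (by omega)
          fun k' _ h2 => out k' (Or.inl (by omega)), ne_of_out (out _ (Or.inl (by omega)))⟩
    obtain ⟨j', hj', hj1, hjj', hj'v⟩ : ∃ j' : ℤ, j' ≤ k + m ∧ k ≤ j' ∧
        P.d v (f ^ j' • x) (f ^ j • x) ≤ C ∧ f ^ j' • x ≠ v := by
      by_cases h : j ≤ k + m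
      · exact ⟨j, h, hkj, hC.self hj, hj⟩
      · exact ⟨k + m, le_rfl, by omega, away v (k + m) j (by omega)
          fun k' h1 _ => out k' (Or.inr (by omega)), ne_of_out (out _ (Or.inr (by omega)))⟩
    obtain ⟨n, hn⟩ := Int.le.dest (hi1.trans hj1)
    have h1 := short v i' n (by omega) hi'v (by rwa [hn])
    rw [hn] at h1
    have h2 := P.triangle v _ _ _ hi hi'v hj
    have h3 := P.triangle v _ _ _ hi'v hj'v hj
    linarith
  refine ⟨2 * C + max b 0, by positivity, fun v i j hi hj => ?_⟩
  rcases le_total i j with h | h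
  · exact main v i j h hi hj
  · rw [P.symmetry v _ _ hi hj]
    exact main v j i h hj hi

theorem graphDist_triangle {V : Type*} {Γ : SimpleGraph V} (hΓ : Γ.Connected) (a b c : V) :
    graphDist Γ a c ≤ graphDist Γ a b + graphDist Γ b c := by
  unfold graphDist
  exact_mod_cast hΓ.dist_triangle

theorem graphDist_comm {V : Type*} (Γ : SimpleGraph V) (a b : V) :
    graphDist Γ a b = graphDist Γ b a := by
  unfold graphDist
  rw [SimpleGraph.dist_comm]

theorem IsActedOnBy.graphDist_smul (hG : P.IsActedOnBy G) (g : G) (x z : Y) :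
    graphDist P.toGraph (g • x) (g • z) = graphDist P.toGraph x z :=
  congrArg Nat.cast (hG.dist_smul g x z)

theorem IsActedOnBy.tendsto_of_isHyperbolicElement (hG : P.IsActedOnBy G) {f : G}
    (hf : IsHyperbolicElement (graphDist P.toGraph) f) (x : Y) :
    Tendsto (fun n : ℕ => graphDist P.toGraph x (f ^ n • x)) atTop atTop := by
  obtain ⟨x₀, τ, hτ, h⟩ := hf
  have h1 : Tendsto (fun n : ℕ => graphDist P.toGraph x₀ (f ^ n • x₀)) atTop atTop := by
    refine (h.pos_mul_atTop hτ tendsto_natCast_atTop_atTop).congr' ?_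
    filter_upwards [eventually_gt_atTop 0] with n hn
    have : (n : ℝ) ≠ 0 := by positivity
    field_simp
  refine tendsto_atTop_mono (fun n => ?_)
    (tendsto_atTop_add_const_right _ (-(2 * graphDist P.toGraph x₀ x)) h1)
  have h2 := graphDist_triangle P.toGraph_connected x₀ x (f ^ n • x₀)
  have h3 := graphDist_triangle P.toGraph_connected x (f ^ n • x) (f ^ n • x₀)
  rw [hG.graphDist_smul, graphDist_comm _ x x₀] at h3
  linarith

theorem IsActedOnBy.exists_orbit_bound_of_isHyperbolicElement (hG : P.IsActedOnBy G) {f : G}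
    (hf : IsHyperbolicElement (graphDist P.toGraph) f) (x : Y) :
    ∃ B : ℝ, 0 ≤ B ∧ ∀ (v : Y) (i j : ℤ), f ^ i • x ≠ v → f ^ j • x ≠ v →
      P.d v (f ^ i • x) (f ^ j • x) ≤ B := by
  obtain ⟨C, hC⟩ := P.exists_isImageBound
  exact hG.exists_orbit_bound hC (hG.tendsto_of_isHyperbolicElement hf x)

end ProjectionComplex

/-! ### Distances in the quotient -/

namespace SpinningFamily

open ProjectionComplex

variable {Y : Type v} {P : ProjectionComplex Y} {G : Type u} [Group G] [MulAction G Y] {L : ℝ}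
  {S : SpinningFamily P G L} {C : ℝ}

theorem proj_surjective (S : SpinningFamily P G L) : Function.Surjective S.proj :=
  Quotient.mk_surjective

theorem proj_smul_of_mem {h : G} (hh : h ∈ S.subgroup) (x : Y) : S.proj (h • x) = S.proj x :=
  S.proj_eq_iff.2 ⟨h, hh, rfl⟩

theorem exists_walk_proj {x z : Y} (p : P.toGraph.Walk x z) :
    ∃ q : S.quotGraph.Walk (S.proj x) (S.proj z), q.length ≤ p.length := by
  induction p with
  | nil => exact ⟨.nil, le_rfl⟩
  | @cons a b c h p ih =>
    obtain ⟨q, hq⟩ := ih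
    by_cases hab : S.proj a = S.proj b
    · refine ⟨q.copy hab.symm rfl, ?_⟩
      rw [SimpleGraph.Walk.length_copy, SimpleGraph.Walk.length_cons]
      omega
    · have hadj : S.quotGraph.Adj (S.proj a) (S.proj b) := ⟨hab, a, b, rfl, rfl, h⟩
      refine ⟨.cons hadj q, ?_⟩
      rw [SimpleGraph.Walk.length_cons, SimpleGraph.Walk.length_cons]
      omega

variable (S) in
theorem quotGraph_connected : S.quotGraph.Connected := by
  obtain ⟨x⟩ := P.toGraph_connected.nonempty
  have : Nonempty S.QuotVertex := ⟨S.proj x⟩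
  refine ⟨fun a b => ?_⟩
  obtain ⟨a, rfl⟩ := S.proj_surjective a
  obtain ⟨b, rfl⟩ := S.proj_surjective b
  obtain ⟨p⟩ := P.toGraph_connected.preconnected a b
  exact ⟨(exists_walk_proj p).choose⟩

theorem graphDist_proj_le (x z : Y) :
    graphDist S.quotGraph (S.proj x) (S.proj z) ≤ graphDist P.toGraph x z := by
  obtain ⟨p, hp⟩ := P.toGraph_connected.exists_walk_length_eq_dist x z
  obtain ⟨q, hq⟩ := exists_walk_proj (S := S) p
  unfold graphDist
  exact_mod_cast (SimpleGraph.dist_le q).trans (hq.trans hp.le)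

theorem exists_smul_dist_le_length (hG : P.IsActedOnBy G) {a b : S.QuotVertex}
    (q : S.quotGraph.Walk a b) : ∀ x z : Y, S.proj x = a → S.proj z = b →
      ∃ h ∈ S.subgroup, P.toGraph.dist x (h • z) ≤ q.length := by
  induction q with
  | nil =>
    rintro x z rfl hz
    obtain ⟨h, hh, rfl⟩ := S.proj_eq_iff.1 hz
    exact ⟨h⁻¹, inv_mem hh, by simp⟩
  | cons hadj q ih =>
    rintro x z rfl hz
    obtain ⟨x', y, hx', hy, hxy⟩ := hadj.2
    obtain ⟨k, hk, rfl⟩ := S.proj_eq_iff.1 hx'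
    obtain ⟨h, hh, hd⟩ := ih (k⁻¹ • y) z ((proj_smul_of_mem (inv_mem hk) y).trans hy) hz
    refine ⟨h, hh, ?_⟩
    have h1 := SimpleGraph.dist_eq_one_iff_adj.2 (hG.adj_smul k⁻¹ hxy)
    rw [inv_smul_smul] at h1
    have h2 := P.toGraph_connected.dist_triangle (u := x) (v := k⁻¹ • y) (w := h • z)
    rw [SimpleGraph.Walk.length_cons]
    omega

theorem exists_smul_graphDist_le (hG : P.IsActedOnBy G) (x z : Y) :
    ∃ h ∈ S.subgroup,
      graphDist P.toGraph x (h • z) ≤ graphDist S.quotGraph (S.proj x) (S.proj z) := by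
  obtain ⟨q, hq⟩ := S.quotGraph_connected.exists_walk_length_eq_dist (S.proj x) (S.proj z)
  obtain ⟨h, hh, hd⟩ := exists_smul_dist_le_length hG q x z rfl rfl
  refine ⟨h, hh, ?_⟩
  unfold graphDist
  exact_mod_cast hd.trans hq.le

/-- Rotating the end of a geodesic about a vertex that it passes does not increase distances. -/
theorem graphDist_rotate_le (hG : P.IsActedOnBy G) (hC : P.IsImageBound C) {x z v : Y} {s : G}
    (hs : s ∈ S.R v) (h : C < P.d v x z ∨ v = x ∨ v = z) :
    graphDist P.toGraph x (s • z) ≤ graphDist P.toGraph x z := by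
  have h1 := P.toGraph_connected.dist_triangle (u := x) (v := v) (w := s • z)
  have h2 : P.toGraph.dist v (s • z) = P.toGraph.dist v z := by
    have := hG.dist_smul s v z
    rwa [smul_self hs] at this
  have h3 : P.toGraph.dist x v + P.toGraph.dist v z ≤ P.toGraph.dist x z := by
    rcases h with h | rfl | rfl
    · exact hC.dist_add_dist_le h
    · simp
    · simp
  unfold graphDist
  exact_mod_cast (by omega : P.toGraph.dist x (s • z) ≤ P.toGraph.dist x z)

theorem IsShortenable.graphDist_le (hG : P.IsActedOnBy G) (hC : P.IsImageBound C) {A B : ℝ}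
    (hA : B + C ≤ A) {x z : Y} (hB : ∀ v, x ≠ v → z ≠ v → P.d v x z ≤ B) {h : G}
    (hh : S.IsShortenable A z h) : graphDist P.toGraph x z ≤ graphDist P.toGraph x (h • z) := by
  induction hh with
  | one => rw [one_smul]
  | @step h s v hs hv hh ih =>
    refine ih.trans ?_
    rw [mul_smul]
    refine graphDist_rotate_le hG hC hs ?_
    rcases hv with hv | ⟨hvz, hvh, hd⟩
    · exact Or.inr (Or.inr hv)
    by_cases hvx : v = x
    · exact Or.inr (Or.inl hvx)
    · left
      have h1 := P.triangle v z x (h • z) (Ne.symm hvz) (Ne.symm hvx) hvh.symm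
      have h2 := hB v (Ne.symm hvx) hvz.symm
      rw [P.symmetry v _ _ (Ne.symm hvx) hvz.symm] at h2
      linarith

/-- The quotient map preserves the distance of two vertices that are not far apart in any
projection. -/
theorem graphDist_proj_eq (hG : P.IsActedOnBy G) (hC : P.IsImageBound C) {B : ℝ} (hB0 : 0 ≤ B)
    (hL : B + 40 * C < L) {x z : Y} (hB : ∀ v, x ≠ v → z ≠ v → P.d v x z ≤ B) :
    graphDist S.quotGraph (S.proj x) (S.proj z) = graphDist P.toGraph x z := by
  have hC0 := hC.nonneg
  refine (graphDist_proj_le x z).antisymm ?_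
  obtain ⟨h, hh, hd⟩ := exists_smul_graphDist_le (S := S) hG x z
  exact ((isShortenable hC hG (by linarith) (A := B + C) (by linarith) z hh).graphDist_le hG hC
    le_rfl hB).trans hd

/-- If `g` moves `x` little and moves `z` close to `h • z`, then some element of the coset of
`g` moves both `x` and `z` little: at each shortening of `h`, the vertex `v` is seen
either by a geodesic from `g • z` to `h • z`, whose end is then rotated, or by a geodesic
from `x` to `g • x`, and then `g` itself is rotated. -/
theorem IsShortenable.exists_close (hG : P.IsActedOnBy G) (hC : P.IsImageBound C) {A B D : ℝ}
    (hA : 2 * B + 2 * C ≤ A) {x z : Y} (hB : ∀ v, x ≠ v → z ≠ v → P.d v x z ≤ B) {h : G}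
    (hh : S.IsShortenable A z h) : ∀ g : G, graphDist P.toGraph x (g • x) ≤ D →
      graphDist P.toGraph (g • z) (h • z) ≤ D → ∃ n ∈ S.subgroup,
        graphDist P.toGraph x ((n * g) • x) ≤ D ∧ graphDist P.toGraph z ((n * g) • z) ≤ D := by
  induction hh with
  | one =>
    intro g hx hz
    rw [one_smul, graphDist_comm] at hz
    exact ⟨1, one_mem _, by simpa using hx, by simpa using hz⟩
  | @step h s v hs hv hh ih =>
    intro g hx hz
    by_cases h1 : C < P.d v (g • z) (h • z) ∨ v = g • z ∨ v = h • z
    · refine ih g hx ?_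
      rw [mul_smul]
      exact (graphDist_rotate_le hG hC hs h1).trans hz
    by_cases h2 : C < P.d v x (g • x) ∨ v = x ∨ v = g • x
    · obtain ⟨n, hn, hnx, hnz⟩ := ih (s * g)
        (by rw [mul_smul]; exact (graphDist_rotate_le hG hC hs h2).trans hx)
        (by rwa [mul_smul, mul_smul, hG.graphDist_smul])
      refine ⟨n * s, mul_mem hn ((le_iSup S.R v : S.R v ≤ S.subgroup) hs), ?_⟩
      rw [mul_assoc]
      exact ⟨hnx, hnz⟩
    exfalso
    push Not at h1 h2
    obtain ⟨h1, hvgz, hvhz⟩ := h1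
    obtain ⟨h2, hvx, hvgx⟩ := h2
    rcases hv with hv | ⟨hvz, -, hd⟩
    · exact hvhz hv
    have h3 := P.triangle v z x (h • z) hvz.symm hvx.symm hvhz.symm
    have h4 := P.triangle v x (g • x) (h • z) hvx.symm hvgx.symm hvhz.symm
    have h5 := P.triangle v (g • x) (g • z) (h • z) hvgx.symm hvgz.symm hvhz.symm
    have h6 := hB v hvx.symm hvz.symm
    rw [P.symmetry v _ _ hvx.symm hvz.symm] at h6
    have h7 := hB (g⁻¹ • v) (fun e => hvgx (by rw [e, smul_inv_smul]))
      (fun e => hvgz (by rw [e, smul_inv_smul]))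
    have h8 := hG.d_smul_right g hvgx.symm hvgz.symm
    rw [inv_smul_smul] at h8
    linarith

/-! ### Hyperbolic, WPD and independent elements of the quotient -/

theorem image_pow_smul_proj (S : SpinningFamily P G L) (f : G) (n : ℕ) (x : Y) :
    S.image f ^ n • S.proj x = S.proj (f ^ n • x) := rfl

theorem image_zpow_smul_proj (S : SpinningFamily P G L) (f : G) (n : ℤ) (x : Y) :
    S.image f ^ n • S.proj x = S.proj (f ^ n • x) := rfl

end SpinningFamily

namespace ProjectionComplex.IsActedOnBy

open SpinningFamily

variable {Y : Type v} {P : ProjectionComplex Y} {G : Type u} [Group G] [MulAction G Y]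

theorem image_isHyperbolicElement (hG : P.IsActedOnBy G) {f : G}
    (hf : IsHyperbolicElement (graphDist P.toGraph) f) :
    ∃ L₀ : ℝ, ∀ L : ℝ, L₀ ≤ L → ∀ S : SpinningFamily P G L,
      IsHyperbolicElement (graphDist S.quotGraph) (S.image f) := by
  obtain ⟨C, hC⟩ := P.exists_isImageBound
  have horb := hG.exists_orbit_bound_of_isHyperbolicElement hf
  obtain ⟨x, τ, hτ, h⟩ := hf
  obtain ⟨B, hB0, hB⟩ := horb x
  refine ⟨B + 40 * C + 1, fun L hL S => ⟨S.proj x, τ, hτ, h.congr fun n => ?_⟩⟩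
  rw [image_pow_smul_proj, graphDist_proj_eq hG hC hB0 (by linarith)]
  intro v h1 h2
  have := hB v 0 n
  simp only [zpow_zero, one_smul, zpow_natCast] at this
  exact this h1 h2

theorem image_isWPDElement (hG : P.IsActedOnBy G) {f : G}
    (hf : IsWPDElement (graphDist P.toGraph) f) :
    ∃ L₀ : ℝ, ∀ L : ℝ, L₀ ≤ L → ∀ S : SpinningFamily P G L,
      IsWPDElement (graphDist S.quotGraph) (S.image f) := by
  obtain ⟨C, hC⟩ := P.exists_isImageBound
  have hC0 := hC.nonneg
  obtain ⟨L₁, hL₁⟩ := hG.image_isHyperbolicElement hf.1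
  obtain ⟨x₀⟩ := P.toGraph_connected.nonempty
  obtain ⟨B, hB0, hB⟩ := hG.exists_orbit_bound_of_isHyperbolicElement hf.1 x₀
  refine ⟨max L₁ (2 * B + 40 * C + 1), fun L hL S => ⟨hL₁ L ((le_max_left _ _).trans hL) S, ?_⟩⟩
  have hL2 := (le_max_right _ _).trans hL
  intro a D hD
  obtain ⟨x, rfl⟩ := S.proj_surjective a
  -- the constant `L₀` is chosen for `x₀`, so the condition at `x` is transported to `x₀`
  set D' := D + 2 * graphDist P.toGraph x₀ x with hD'
  have hdist : 0 ≤ graphDist P.toGraph x₀ x := Nat.cast_nonneg _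
  obtain ⟨M, hM⟩ := hf.2 x₀ D' (by positivity)
  refine ⟨M, (hM.image S.image).subset ?_⟩
  rintro ⟨g⟩ ⟨h1, h2⟩
  change graphDist S.quotGraph (S.proj x) (S.proj (g • x)) ≤ D at h1
  change graphDist S.quotGraph (S.proj (f ^ M • x)) (S.proj (g • f ^ M • x)) ≤ D at h2
  have move (k : G) (h : graphDist S.quotGraph (S.proj (k • x)) (S.proj (g • k • x)) ≤ D) :
      graphDist S.quotGraph (S.proj (k • x₀)) (S.proj (g • k • x₀)) ≤ D' := by
    have e1 := graphDist_triangle S.quotGraph_connected (S.proj (k • x₀)) (S.proj (k • x))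
      (S.proj (g • k • x₀))
    have e2 := graphDist_triangle S.quotGraph_connected (S.proj (k • x)) (S.proj (g • k • x))
      (S.proj (g • k • x₀))
    have e3 := graphDist_proj_le (S := S) (k • x₀) (k • x)
    have e4 := graphDist_proj_le (S := S) (g • k • x) (g • k • x₀)
    rw [hG.graphDist_smul] at e3
    rw [hG.graphDist_smul, hG.graphDist_smul, graphDist_comm P.toGraph] at e4
    linarith
  have h1 := move 1 (by simpa using h1)
  rw [one_smul] at h1
  have h2 := move (f ^ M) h2
  obtain ⟨n, hn, hnx⟩ := exists_smul_graphDist_le hG x₀ (g • x₀)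
  have h3 : graphDist S.quotGraph (S.proj ((n * g) • f ^ M • x₀)) (S.proj (f ^ M • x₀)) ≤ D' := by
    rw [mul_smul, proj_smul_of_mem hn, graphDist_comm]
    exact h2
  obtain ⟨h, hh, hd⟩ := exists_smul_graphDist_le hG ((n * g) • f ^ M • x₀) (f ^ M • x₀)
  have hsh := isShortenable hC hG (by linarith) (A := 2 * B + 2 * C) (by linarith)
    (f ^ M • x₀) hh
  obtain ⟨k, hk, hkx, hkz⟩ := hsh.exists_close hG hC (D := D') le_rfl
    (fun v e1 e2 => by
      have := hB v 0 M
      simp only [zpow_zero, one_smul, zpow_natCast] at this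
      exact this e1 e2) (n * g)
    (by rw [mul_smul]; exact hnx.trans h1) (hd.trans h3)
  refine ⟨k * (n * g), ⟨hkx, hkz⟩, ?_⟩
  rw [← mul_assoc]
  have e : (QuotientGroup.mk (k * n) : G ⧸ S.subgroup) = 1 :=
    (QuotientGroup.eq_one_iff _).2 (mul_mem hk hn)
  change (QuotientGroup.mk (k * n * g) : G ⧸ S.subgroup) = QuotientGroup.mk g
  rw [QuotientGroup.mk_mul, e, one_mul]

theorem image_areIndependent (hG : P.IsActedOnBy G) {f₁ f₂ : G}
    (hf : AreIndependent (graphDist P.toGraph) f₁ f₂) :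
    ∃ L₀ : ℝ, ∀ L : ℝ, L₀ ≤ L → ∀ S : SpinningFamily P G L,
      AreIndependent (graphDist S.quotGraph) (S.image f₁) (S.image f₂) := by
  obtain ⟨C, hC⟩ := P.exists_isImageBound
  obtain ⟨hf₁, hf₂, x, hx⟩ := hf
  obtain ⟨L₁, hL₁⟩ := hG.image_isHyperbolicElement hf₁
  obtain ⟨L₂, hL₂⟩ := hG.image_isHyperbolicElement hf₂
  obtain ⟨B₁, hB₁0, hB₁⟩ := hG.exists_orbit_bound_of_isHyperbolicElement hf₁ x
  obtain ⟨B₂, hB₂0, hB₂⟩ := hG.exists_orbit_bound_of_isHyperbolicElement hf₂ x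
  obtain ⟨K, hK⟩ := P.exists_projection_bound (f₁ • x) (f₂ • x)
  have ne {f : G} (hf : IsHyperbolicElement (graphDist P.toGraph) f) : f • x ≠ x := by
    intro e
    have h := hG.tendsto_of_isHyperbolicElement hf x
    have e' (n : ℕ) : f ^ n • x = x := by
      induction n with
      | zero => simp
      | succ n ih => rw [pow_succ, mul_smul, e, ih]
    simp only [e'] at h
    exact not_tendsto_const_atTop _ _ h
  have hB (v : Y) (m n : ℤ) (h1 : f₁ ^ m • x ≠ v) (h2 : f₂ ^ n • x ≠ v) :
      P.d v (f₁ ^ m • x) (f₂ ^ n • x) ≤ B₁ + max K 0 + B₂ := by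
    have hK0 := le_max_left K 0
    have hK1 := le_max_right K 0
    by_cases hv : x = v
    · -- `x` is not available as an intermediate point, so `f₁ • x` and `f₂ • x` replace it
      subst hv
      have a1 := hB₁ x m 1 h1 (by simpa using ne hf₁)
      have a2 := hB₂ x 1 n (by simpa using ne hf₂) h2
      rw [zpow_one] at a1 a2
      have a3 := hK x (ne hf₁) (ne hf₂)
      have a4 := P.triangle x _ _ _ h1 (ne hf₁) h2
      have a5 := P.triangle x _ _ _ (ne hf₁) (ne hf₂) h2
      linarith
    · have a1 := hB₁ v m 0 h1 (by simpa using hv)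
      have a2 := hB₂ v 0 n (by simpa using hv) h2
      rw [zpow_zero, one_smul] at a1 a2
      have a3 := P.triangle v _ _ _ h1 hv h2
      linarith
  refine ⟨max (max L₁ L₂) (B₁ + max K 0 + B₂ + 40 * C + 1), fun L hL S =>
    ⟨hL₁ L (((le_max_left _ _).trans (le_max_left _ _)).trans hL) S,
      hL₂ L (((le_max_right _ _).trans (le_max_left _ _)).trans hL) S, S.proj x,
      hx.congr fun n => ?_⟩⟩
  have hL3 := (le_max_right _ _).trans hL
  rw [image_zpow_smul_proj, image_zpow_smul_proj,
    graphDist_proj_eq hG hC (B := B₁ + max K 0 + B₂) (by positivity) (by linarith)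
      fun v => hB v n.1 n.2]

theorem image_areIndependentWPD (hG : P.IsActedOnBy G) {f₁ f₂ : G}
    (hf : AreIndependentWPD (graphDist P.toGraph) f₁ f₂) :
    ∃ L₀ : ℝ, 0 < L₀ ∧ ∀ L : ℝ, L₀ ≤ L → ∀ S : SpinningFamily P G L,
      AreIndependentWPD (graphDist S.quotGraph) (S.image f₁) (S.image f₂) := by
  obtain ⟨L₁, h₁⟩ := hG.image_isWPDElement hf.1
  obtain ⟨L₂, h₂⟩ := hG.image_isWPDElement hf.2.1
  obtain ⟨L₃, h₃⟩ := hG.image_areIndependent hf.2.2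
  refine ⟨max 1 (max L₁ (max L₂ L₃)), lt_max_of_lt_left one_pos, fun L hL S => ?_⟩
  obtain ⟨-, hL⟩ := max_le_iff.1 hL
  obtain ⟨hL1, hL⟩ := max_le_iff.1 hL
  obtain ⟨hL2, hL3⟩ := max_le_iff.1 hL
  exact ⟨h₁ L hL1 S, h₂ L hL2 S, h₃ L hL3 S⟩

end ProjectionComplex.IsActedOnBy

theorem theorem1p2 {Y : Type v} (P : ProjectionComplex Y) (G : Type u) [Group G] [MulAction G Y]
    (hG : P.IsActedOnBy G) :
    (IsNonelementaryWPDAction G (graphDist P.toGraph) →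
      ∃ L₀ : ℝ, 0 < L₀ ∧ ∀ L : ℝ, L₀ ≤ L → ∀ S : SpinningFamily P G L,
        IsNonelementaryWPDAction (G ⧸ S.subgroup) (graphDist S.quotGraph)) ∧
    (∀ f₁ f₂ : G, AreIndependentWPD (graphDist P.toGraph) f₁ f₂ →
      ∃ L₀ : ℝ, 0 < L₀ ∧ ∀ L : ℝ, L₀ ≤ L → ∀ S : SpinningFamily P G L,
        AreIndependentWPD (graphDist S.quotGraph) (S.image f₁) (S.image f₂)) := by
  refine ⟨?_, fun f₁ f₂ hf => hG.image_areIndependentWPD hf⟩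
  rintro ⟨f₁, f₂, hf⟩
  obtain ⟨L₀, hL₀, h⟩ := hG.image_areIndependentWPD hf
  exact ⟨L₀, hL₀, fun L hL S => ⟨S.image f₁, S.image f₂, h L hL S⟩⟩
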